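/- Let $\lambda>0$ and let $v\ge 0$ be a measurable function on $\mathbb R^+=[0,\infty)$. For $0<r\le\infty$ let $L^r=L^r(\mathbb R^+)$ be the (real or complex) Lebesgue space with (quasi-)norm $\|\cdot\|_r$, for $1<p\le\infty$ put $p'=p/(p-1)$ (with $p'=1$ if $p=\infty$), and let $$\mathcal L f(x)=\int_0^\infty e^{-xy^\lambda}f(y)v(y)\,dy,\qquad x\in\mathbb R^+ .$$ We say that $\mathcal L$ is compact from $L^p$ to $L^q$ if for every $f\in L^p$ the integral converges absolutely for almost every $x$ and $\mathcal Lf\in L^q$, and for every bounded sequence $(f_n)$ in $L^p$ the sequence $(\mathcal Lf_n)$ has a subsequence converging in $L^q$. With the convention $0\cdot\infty=0$, define in $[0,\infty]$ $$C_{q>1}=\Bigl(\int_0^\infty t^{-\lambda}\Bigl(\int_0^t v(y)\,dy\Bigr)^{q-1}v(t)\,dt\Bigr)^{1/q},\qquad C_{q=1}=\int_0^\infty y^{-\lambda}v(y)\,dy,\qquad C_{q<1}=\int_0^\infty t^{-\lambda/q}v(t)\,dt,$$ where the first expression is considered for every $q>0$, $q\neq 1$ (in particular for $q<1$). Put $C_q=C_{q=1}$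 if $q=1$ and $C_q=C_{q>1}$ if $1<q<\infty$. (i) Let $v\in L^1_{loc}([0,\infty))$ (that is, $\int_0^tv<\infty$ for every $t>0$) and $1\le q<\infty$. Then $\mathcal L$ is compact from $L^\infty$ to $L^q$ if and only if $C_q<\infty$. (ii) Let $v\in L^1_{loc}([0,\infty))$ and $0<q<1$. If $C_{q>1}<\infty$, then $\mathcal L$ is compact from $L^\infty$ to $L^q$. If $\mathcal L$ is compact from $L^\infty$ to $L^q$, then $C_{q<1}<\infty$. (iii) Let $1<p\le\infty$ and $v\in L^{p'}_{loc}([0,\infty))$ (that is, $\|v\chi_{[0,t]}\|_{p'}<\infty$ for every $t>0$). Then $\mathcal L$ is compact from $L^p$ to $L^\infty$ if and only if $\|v\|_{p'}<\infty$. -/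

import Mathlib

open MeasureTheory Set Filter Topology
open scoped ENNReal NNReal

noncomputable section

/-- Lebesgue measure on the half line `[0, ∞)` (the end point `0` is a null set). -/
abbrev halfLine : Measure ℝ := volume.restrict (Ioi (0 : ℝ))

/-- `v ∈ L^r_loc([0, ∞))`: `v` is measurable with finite `L^r` norm on every `[0, t]`. -/
def LocLp (v : ℝ → ℝ) (r : ℝ≥0∞) : Prop :=
  ∀ t : ℝ, 0 < t → MemLp v r (volume.restrict (Icc 0 t))

/-- The integrand `y ↦ exp (-x y^lam) f(y) v(y)` of the Laplace type transform. -/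
def laplaceIntegrand {𝕜 : Type*} [RCLike 𝕜] (lam : ℝ) (v : ℝ → ℝ) (f : ℝ → 𝕜) (x : ℝ) :
    ℝ → 𝕜 :=
  fun y => (Real.exp (-(x * y ^ lam)) * v y) • f y

/-- The Laplace type transform `(𝓛 f)(x) = ∫_0^∞ exp (-x y^lam) f(y) v(y) dy`. -/
def laplaceOp {𝕜 : Type*} [RCLike 𝕜] (lam : ℝ) (v : ℝ → ℝ) (f : ℝ → 𝕜) : ℝ → 𝕜 :=
  fun x => ∫ y, laplaceIntegrand lam v f x y ∂halfLine

/-- `𝓛` is a compact operator from `L^p([0, ∞))` to `L^q([0, ∞))`, `0 < p, q ≤ ∞`: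
it is defined on all of `L^p` (the integral converges absolutely for almost every `x`), takes
its values in `L^q`, and the image of every norm-bounded sequence has a subsequence that
converges in `L^q`. For `q < 1` convergence refers to the quasi-norm of `L^q`. -/
structure LaplaceCompact (𝕜 : Type*) [RCLike 𝕜] (lam : ℝ) (v : ℝ → ℝ) (p q : ℝ≥0∞) :
    Prop where
  integrable : ∀ f : ℝ → 𝕜, MemLp f p halfLine →
    ∀ᵐ x ∂halfLine, Integrable (laplaceIntegrand lam v f x) halfLine
  memLp : ∀ f : ℝ → 𝕜, MemLp f p halfLine → MemLp (laplaceOp lam v f) q halfLine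
  compact : ∀ f : ℕ → ℝ → 𝕜, (∀ n, MemLp (f n) p halfLine) →
    (∃ M : ℝ≥0, ∀ n, eLpNorm (f n) p halfLine ≤ M) →
    ∃ φ : ℕ → ℕ, StrictMono φ ∧ ∃ g : ℝ → 𝕜, MemLp g q halfLine ∧
      Tendsto (fun k => eLpNorm (laplaceOp lam v (f (φ k)) - g) q halfLine) atTop (𝓝 0)

/-- `C_{q>1} = (∫_0^∞ t^{-lam} (∫_0^t v)^{q-1} v(t) dt)^{1/q}`, with values in `[0, ∞]` and
with `0 · ∞ = 0`. -/
def constGtOne (lam q : ℝ) (v : ℝ → ℝ) : ℝ≥0∞ :=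
  (∫⁻ t, ENNReal.ofReal (t ^ (-lam)) *
      (∫⁻ y in Ioc 0 t, ENNReal.ofReal (v y)) ^ (q - 1) * ENNReal.ofReal (v t) ∂halfLine) ^
    (1 / q)

/-- `C_{q=1} = ∫_0^∞ y^{-lam} v(y) dy`. -/
def constEqOne (lam : ℝ) (v : ℝ → ℝ) : ℝ≥0∞ :=
  ∫⁻ y, ENNReal.ofReal (y ^ (-lam)) * ENNReal.ofReal (v y) ∂halfLine

/-- `C_{q<1} = ∫_0^∞ t^{-lam/q} v(t) dt`. -/
def constLtOne (lam q : ℝ) (v : ℝ → ℝ) : ℝ≥0∞ :=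
  ∫⁻ t, ENNReal.ofReal (t ^ (-lam / q)) * ENNReal.ofReal (v t) ∂halfLine

/-- `C_q` for `1 ≤ q < ∞`: it is `C_{q=1}` if `q = 1` and `C_{q>1}` otherwise. -/
def constC (lam q : ℝ) (v : ℝ → ℝ) : ℝ≥0∞ :=
  if q = 1 then constEqOne lam v else constGtOne lam q v

end

/-!
Write `V(t) = ∫_0^t v`, `G(x) = V(x^{-1/lam})` and `Φ(x) = ∫_0^∞ exp (-x y^lam) v(y) dy`, the
transform of the constant function `1`.

**From `L^∞` to `L^q`, `0 < q < ∞`.** The operator is compact exactly when `Φ ∈ L^q`. Necessity is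
the test function `1`. For sufficiency, `Φ` is antitone, hence finite on `(0, ∞)`, so all kernels
`exp (-x y^lam) v(y)` with `x > 0` lie in `L^1`; a diagonal argument over the positive rationals
and the continuity of the kernels in `x` give a subsequence whose transforms converge at every
`x > 0`, and `Φ` dominates (`laplaceCompact_top_iff`). It remains to compute with `Φ`:

* `Φ ∈ L^q` iff `G ∈ L^q`, because `e⁻¹ G(x) ≤ Φ(x) ≤ ∑ k, e^{-k} G(x / (k + 1))`
  (`lintegral_laplaceMass_rpow_lt_top_iff`);
* `∫ G^q = q ∫ t^{-lam} V^{q-1} v dt` by Tonelli, since `V` pushes `v dt` forward to Lebesgue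
  measure and so `∫_0^s V^{q-1} v = V(s)^q / q` (`lintegral_rpow_mul_primitiveMass`).

So `C_{q>1} < ∞` characterises compactness for every `q > 0` (for `q = 1` it is `C_{q=1}`). For
`q < 1` it implies `C_{q<1} < ∞` since `t^{-lam} V(t)^q ≤ ∫ G^q` bounds `V^{q-1}` from below
(`lintegral_rpow_div_mul_lt_top`).

**From `L^p` to `L^∞`.** Let `r` be the exponent conjugate to `p`, which is finite. If `v ∈ L^r`,
then the kernels depend continuously in `L^r` on `x ∈ [0, ∞)` and tend to `0` as `x → ∞`, so they
form a relatively compact set, and by Hölder's inequality pointwise convergence of the transforms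
of a bounded sequence at the positive rationals is uniform (`uniformCauchySeqOn_laplaceOp`).
Conversely, for `f ≥ 0` the transform tends to `∫ f v` as `x → 0`; taking for `f` the normalised
extremal functions `v^{r-1}` on `(0, n]` and using compactness to bound their transforms along a
subsequence bounds `v` in `L^r` (`LaplaceCompact.eLpNorm_lt_top`).
-/

/-! ### The primitive of the weight and its powers -/

/-- The primitive `t ↦ ∫_0^t w` of a weight, with values in `[0, ∞]`. -/
noncomputable def primitiveMass (w : ℝ → ℝ≥0∞) (t : ℝ) : ℝ≥0∞ := ∫⁻ y in Ioc 0 t, w y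

lemma primitiveMass_mono (w : ℝ → ℝ≥0∞) : Monotone (primitiveMass w) := fun _ _ h =>
  lintegral_mono_set (Ioc_subset_Ioc_right h)

lemma primitiveMass_zero (w : ℝ → ℝ≥0∞) : primitiveMass w 0 = 0 := by
  simp [primitiveMass]

lemma primitiveMass_toReal_continuousOn {w : ℝ → ℝ≥0∞} (hw : Measurable w)
    (hfin : ∀ t, primitiveMass w t < ∞) (s : ℝ) :
    ContinuousOn (fun t => (primitiveMass w t).toReal) (Icc 0 s) := by
  have hint : IntegrableOn (fun y => (w y).toReal) (Icc 0 s) := by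
    rw [integrableOn_Icc_iff_integrableOn_Ioc]
    exact integrable_toReal_of_lintegral_ne_top hw.aemeasurable (hfin s).ne
  refine (intervalIntegral.continuousOn_primitive hint).congr fun t _ => ?_
  exact (integral_toReal hw.aemeasurable (ae_lt_top hw (hfin t).ne)).symm

/-- The primitive `V` of a weight `w` pushes the measure `w dt` on `(0, s]` forward to Lebesgue
measure on `(0, V(s)]`; this is the change of variables `u = V(t)`. -/
lemma map_primitiveMass {w : ℝ → ℝ≥0∞} (hw : Measurable w)
    (hfin : ∀ t, primitiveMass w t < ∞) {s : ℝ} (hs : 0 ≤ s) :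
    ((volume.restrict (Ioc 0 s)).withDensity w).map (fun t => (primitiveMass w t).toReal) =
      volume.restrict (Ioc 0 (primitiveMass w s).toReal) := by
  set V : ℝ → ℝ := fun t => (primitiveMass w t).toReal with hV
  have hVmono : Monotone V := fun a b hab =>
    ENNReal.toReal_mono (hfin b).ne (primitiveMass_mono w hab)
  have hV0 : V 0 = 0 := by simp [hV, primitiveMass_zero]
  have hVnn : ∀ t, 0 ≤ V t := fun t => ENNReal.toReal_nonneg
  have : IsFiniteMeasure ((volume.restrict (Ioc 0 s)).withDensity w) :=
    isFiniteMeasure_withDensity (hfin s).ne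
  refine Measure.ext_of_Iic _ _ fun c => ?_
  rw [Measure.map_apply hVmono.measurable measurableSet_Iic,
    withDensity_apply _ (hVmono.measurable measurableSet_Iic),
    Measure.restrict_restrict (hVmono.measurable measurableSet_Iic),
    Measure.restrict_apply measurableSet_Iic]
  rcases lt_or_ge c 0 with hc | hc
  · have h1 : V ⁻¹' Iic c ∩ Ioc 0 s = ∅ := by
      ext t; simp only [mem_inter_iff, mem_preimage, mem_Iic, mem_empty_iff_false, iff_false]
      intro h; linarith [h.1, hVnn t]
    have h2 : Iic c ∩ Ioc 0 (V s) = ∅ := by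
      ext t; simp only [mem_inter_iff, mem_Iic, mem_Ioc, mem_empty_iff_false, iff_false]
      intro h; linarith [h.1, h.2.1]
    rw [h1, h2]; simp
  rcases le_or_gt (V s) c with hcs | hcs
  · have h1 : V ⁻¹' Iic c ∩ Ioc 0 s = Ioc 0 s :=
      inter_eq_right.2 fun t ht => (hVmono ht.2).trans hcs
    have h2 : Iic c ∩ Ioc 0 (V s) = Ioc 0 (V s) :=
      inter_eq_right.2 fun t ht => le_trans ht.2 hcs
    rw [h1, h2, Real.volume_Ioc, sub_zero, hV, ENNReal.ofReal_toReal (hfin s).ne]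
    rfl
  · have hcont := primitiveMass_toReal_continuousOn hw hfin s
    have hK : IsCompact (Icc 0 s ∩ V ⁻¹' Iic c) :=
      isCompact_Icc.of_isClosed_subset
        (hcont.preimage_isClosed_of_isClosed isClosed_Icc isClosed_Iic) inter_subset_left
    obtain ⟨T, ⟨hT, hTc⟩, hTmax⟩ := hK.exists_isGreatest
      ⟨0, ⟨le_rfl, hs⟩, by simpa [hV0] using hc⟩
    -- The largest `T` with `V(T) ≤ c` satisfies `V(T) = c`.
    have hVT : V T = c := by
      obtain ⟨t, ht, htc⟩ := intermediate_value_Icc hT.2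
        (hcont.mono (Icc_subset_Icc_left hT.1)) ⟨hTc, hcs.le⟩
      have : t ≤ T := hTmax ⟨⟨hT.1.trans ht.1, ht.2⟩, htc.le⟩
      rwa [le_antisymm this ht.1] at htc
    have h1 : V ⁻¹' Iic c ∩ Ioc 0 s = Ioc 0 T := by
      ext t
      constructor
      · rintro ⟨h, h0, h1⟩
        exact ⟨h0, hTmax ⟨⟨h0.le, h1⟩, h⟩⟩
      · rintro ⟨h0, h1⟩
        exact ⟨(hVmono h1).trans hVT.le, h0, h1.trans hT.2⟩
    have h2 : Iic c ∩ Ioc 0 (V s) = Ioc 0 c := by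
      ext u
      simp only [mem_inter_iff, mem_Iic, mem_Ioc]
      exact ⟨fun h => ⟨h.2.1, h.1⟩, fun h => ⟨h.2, h.1, h.2.trans hcs.le⟩⟩
    rw [h1, h2, Real.volume_Ioc, sub_zero, ← hVT, hV, ENNReal.ofReal_toReal (hfin T).ne]
    rfl

/-- `∫_0^s V^{q-1} w = V(s)^q / q` for the primitive `V` of `w` and every `q > 0`. -/
lemma setLIntegral_primitiveMass_rpow {w : ℝ → ℝ≥0∞} (hw : Measurable w)
    (hfin : ∀ t, primitiveMass w t < ∞) {q : ℝ} (hq : 0 < q) {s : ℝ} (hs : 0 ≤ s) :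
    ∫⁻ t in Ioc 0 s, primitiveMass w t ^ (q - 1) * w t =
      primitiveMass w s ^ q / ENNReal.ofReal q := by
  have hVm : Measurable (primitiveMass w) := (primitiveMass_mono w).measurable
  have hgm : Measurable fun u : ℝ => ENNReal.ofReal u ^ (q - 1) := by fun_prop
  have hS : 0 ≤ (primitiveMass w s).toReal := ENNReal.toReal_nonneg
  have e1 : ∫⁻ t in Ioc 0 s, primitiveMass w t ^ (q - 1) * w t =
      ∫⁻ u in Ioc 0 (primitiveMass w s).toReal, ENNReal.ofReal u ^ (q - 1) := by
    rw [← map_primitiveMass hw hfin hs, lintegral_map hgm hVm.ennreal_toReal]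
    refine Eq.trans ?_
      (lintegral_withDensity_eq_lintegral_mul _ hw (hgm.comp hVm.ennreal_toReal)).symm
    refine lintegral_congr fun t => ?_
    simp only [Pi.mul_apply, Function.comp_apply]
    rw [ENNReal.ofReal_toReal (hfin t).ne, mul_comm]
  have hii : IntervalIntegrable (fun u : ℝ => u ^ (q - 1)) volume 0 (primitiveMass w s).toReal :=
    intervalIntegral.intervalIntegrable_rpow' (by linarith)
  rw [e1, setLIntegral_congr_fun measurableSet_Ioc
    (fun u hu => ENNReal.ofReal_rpow_of_pos (p := q - 1) hu.1),
    ← ofReal_integral_eq_lintegral_ofReal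
      ((intervalIntegrable_iff_integrableOn_Ioc_of_le hS).1 hii)
      ((ae_restrict_mem measurableSet_Ioc).mono fun u hu => Real.rpow_nonneg hu.1.le _),
    ← intervalIntegral.integral_of_le hS, integral_rpow (Or.inl (by linarith))]
  rw [sub_add_cancel, Real.zero_rpow hq.ne', sub_zero, ENNReal.ofReal_div_of_pos hq,
    ← ENNReal.ofReal_rpow_of_nonneg hS hq.le, ENNReal.ofReal_toReal (hfin s).ne]

/-- Writing `t^{-lam}` as the length of `(0, t^{-lam}]` and exchanging integrals turns the
integral defining `constGtOne` into the `L^q` norm of `x ↦ V(x^{-1/lam})`. -/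
lemma lintegral_rpow_mul_primitiveMass {w : ℝ → ℝ≥0∞} (hw : Measurable w)
    (hfin : ∀ t, primitiveMass w t < ∞) {lam q : ℝ} (hlam : 0 < lam) (hq : 0 < q) :
    ∫⁻ t in Ioi 0, ENNReal.ofReal (t ^ (-lam)) * primitiveMass w t ^ (q - 1) * w t =
      (∫⁻ x in Ioi 0, primitiveMass w (x ^ (-lam⁻¹)) ^ q) / ENNReal.ofReal q := by
  have hVm : Measurable (primitiveMass w) := (primitiveMass_mono w).measurable
  set h : ℝ → ℝ≥0∞ := fun t => primitiveMass w t ^ (q - 1) * w t with hh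
  have hhm : Measurable h := (hVm.pow_const _).mul hw
  have hset : MeasurableSet {z : ℝ × ℝ | z.2 ≤ z.1 ^ (-lam)} :=
    measurableSet_le measurable_snd (by fun_prop)
  calc ∫⁻ t in Ioi 0, ENNReal.ofReal (t ^ (-lam)) * primitiveMass w t ^ (q - 1) * w t
      = ∫⁻ t in Ioi 0, ∫⁻ x in Ioi 0,
          {z : ℝ × ℝ | z.2 ≤ z.1 ^ (-lam)}.indicator (fun z => h z.1) (t, x) := by
        refine setLIntegral_congr_fun measurableSet_Ioi fun t _ => ?_
        have : (fun x => {z : ℝ × ℝ | z.2 ≤ z.1 ^ (-lam)}.indicator (fun z => h z.1) (t, x)) =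
            (Iic (t ^ (-lam))).indicator (fun _ => h t) := by
          ext x; simp [indicator]
        simp only [this]
        rw [lintegral_indicator measurableSet_Iic, Measure.restrict_restrict measurableSet_Iic,
          Iic_inter_Ioi, setLIntegral_const, Real.volume_Ioc, sub_zero, mul_assoc,
          mul_comm (h t)]
    _ = ∫⁻ x in Ioi 0, ∫⁻ t in Ioi 0,
          {z : ℝ × ℝ | z.2 ≤ z.1 ^ (-lam)}.indicator (fun z => h z.1) (t, x) :=
        lintegral_lintegral_swap ((hhm.comp measurable_fst).indicator hset).aemeasurable
    _ = ∫⁻ x in Ioi 0, primitiveMass w (x ^ (-lam⁻¹)) ^ q / ENNReal.ofReal q := by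
        refine setLIntegral_congr_fun measurableSet_Ioi fun x hx => ?_
        rw [mem_Ioi] at hx
        have hxs : 0 ≤ x ^ (-lam⁻¹) := Real.rpow_nonneg hx.le _
        have : ∀ t ∈ Ioi (0 : ℝ),
            {z : ℝ × ℝ | z.2 ≤ z.1 ^ (-lam)}.indicator (fun z => h z.1) (t, x) =
              (Iic (x ^ (-lam⁻¹))).indicator h t := by
          intro t ht
          have : x ≤ t ^ (-lam) ↔ t ≤ x ^ (-lam⁻¹) := by
            have := Real.le_rpow_inv_iff_of_neg (x := t) (y := x) (z := -lam) ht hx (by linarith)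
            rw [inv_neg] at this
            exact this.symm
          simp [indicator, this]
        rw [setLIntegral_congr_fun measurableSet_Ioi this, lintegral_indicator measurableSet_Iic,
          Measure.restrict_restrict measurableSet_Iic, Iic_inter_Ioi,
          setLIntegral_primitiveMass_rpow hw hfin hq hxs]
    _ = _ := by
        simp only [div_eq_mul_inv]
        rw [lintegral_mul_const]
        exact (hVm.comp (by fun_prop)).pow_const _

/-! ### Comparing the transform of a weight with its primitive -/

/-- The transform `x ↦ ∫_0^∞ exp (-x y^lam) w(y) dy` of a weight, with values in `[0, ∞]`. -/
noncomputable def laplaceMass (lam : ℝ) (w : ℝ → ℝ≥0∞) (x : ℝ) : ℝ≥0∞ :=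
  ∫⁻ y in Ioi 0, ENNReal.ofReal (Real.exp (-(x * y ^ lam))) * w y

lemma laplaceMass_antitone (lam : ℝ) (w : ℝ → ℝ≥0∞) : Antitone (laplaceMass lam w) := by
  intro a b hab
  refine setLIntegral_mono' measurableSet_Ioi fun y hy => ?_
  have : 0 ≤ y ^ lam := Real.rpow_nonneg (le_of_lt hy) _
  gcongr

lemma lintegral_Ioi_comp_div {h : ℝ → ℝ≥0∞} (hh : Measurable h) {c : ℝ} (hc : 0 < c) :
    ∫⁻ x in Ioi 0, h (x / c) = ENNReal.ofReal c * ∫⁻ x in Ioi 0, h x := by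
  have hpre : (fun x : ℝ => c⁻¹ * x) ⁻¹' Ioi 0 = Ioi 0 := by
    ext x; simp [hc]
  have := setLIntegral_map (μ := (volume : Measure ℝ)) (measurableSet_Ioi (a := (0 : ℝ))) hh
    (measurable_const_mul c⁻¹)
  rw [hpre, Real.map_volume_mul_left (inv_ne_zero hc.ne'), inv_inv, abs_of_pos hc,
    Measure.restrict_smul, lintegral_smul_measure] at this
  simp only [div_eq_inv_mul]
  rw [← this, smul_eq_mul]

lemma exp_neg_one_mul_primitiveMass_le (lam : ℝ) (w : ℝ → ℝ≥0∞) (hlam : 0 < lam) {x : ℝ}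
    (hx : 0 < x) :
    ENNReal.ofReal (Real.exp (-1)) * primitiveMass w (x ^ (-lam⁻¹)) ≤ laplaceMass lam w x := by
  rw [primitiveMass, ← lintegral_const_mul' _ _ ENNReal.ofReal_ne_top]
  calc _ ≤ ∫⁻ y in Ioc 0 (x ^ (-lam⁻¹)), ENNReal.ofReal (Real.exp (-(x * y ^ lam))) * w y := by
        refine setLIntegral_mono' measurableSet_Ioc fun y hy => ?_
        have h1 : y ^ lam ≤ (x ^ (-lam⁻¹)) ^ lam := Real.rpow_le_rpow hy.1.le hy.2 hlam.le
        rw [← Real.rpow_mul hx.le, neg_mul, inv_mul_cancel₀ hlam.ne', Real.rpow_neg_one] at h1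
        have h2 : x * y ^ lam ≤ 1 := by
          calc x * y ^ lam ≤ x * x⁻¹ := by gcongr
            _ = 1 := mul_inv_cancel₀ hx.ne'
        gcongr
    _ ≤ _ := lintegral_mono_set Ioc_subset_Ioi_self

/-- Cutting `(0, ∞)` at the points where `x y^lam` is an integer dominates the transform by a
geometrically weighted sum of dilates of `x ↦ V(x^{-1/lam})`. -/
lemma laplaceMass_le_tsum {lam : ℝ} {w : ℝ → ℝ≥0∞} (hw : Measurable w) (hlam : 0 < lam) {x : ℝ}
    (hx : 0 < x) :
    laplaceMass lam w x ≤ ∑' k : ℕ, ENNReal.ofReal (Real.exp (-k)) *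
      primitiveMass w ((x / (k + 1)) ^ (-lam⁻¹)) := by
  set T : ℕ → ℝ := fun k => (x / (k + 1)) ^ (-lam⁻¹) with hT
  have e : ∀ k : ℕ, ENNReal.ofReal (Real.exp (-k)) * primitiveMass w (T k) =
      ∫⁻ y in Ioi 0, (Ioc 0 (T k)).indicator (fun y => ENNReal.ofReal (Real.exp (-k)) * w y) y := by
    intro k
    rw [lintegral_indicator measurableSet_Ioc, Measure.restrict_restrict measurableSet_Ioc,
      inter_eq_left.2 Ioc_subset_Ioi_self, lintegral_const_mul _ hw, primitiveMass]
  rw [tsum_congr e, ← lintegral_tsum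
    fun k => ((hw.const_mul _).indicator measurableSet_Ioc).aemeasurable, laplaceMass]
  refine setLIntegral_mono' measurableSet_Ioi fun y hy => ?_
  rw [mem_Ioi] at hy
  have hyl : 0 ≤ x * y ^ lam := by positivity
  set k := ⌊x * y ^ lam⌋₊ with hk
  have hk1 : (k : ℝ) ≤ x * y ^ lam := Nat.floor_le hyl
  have hk2 : x * y ^ lam < k + 1 := Nat.lt_floor_add_one _
  have hpos : 0 < x / (k + 1) := by positivity
  have hmem : y ∈ Ioc 0 (T k) := by
    refine ⟨hy, ?_⟩
    have h := (Real.le_rpow_inv_iff_of_neg (x := y) (y := x / (k + 1)) (z := -lam) hy hpos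
      (by linarith)).2
    rw [inv_neg] at h
    refine h ?_
    rw [Real.rpow_neg hy.le, div_le_iff₀ (by positivity), inv_mul_eq_div,
      le_div_iff₀ (by positivity)]
    exact hk2.le
  refine le_trans ?_ (ENNReal.le_tsum k)
  rw [indicator_of_mem hmem]
  gcongr

/-- An inequality that replaces Minkowski's for `q ≥ 1` and subadditivity for `q ≤ 1`. -/
lemma tsum_pow_mul_pow_mul_rpow_le (r : ℝ≥0∞) (a : ℕ → ℝ≥0∞) {q : ℝ} (hq : 0 < q) :
    (∑' k, r ^ k * (r ^ k * a k)) ^ q ≤ (∑' k, r ^ k) ^ q * ∑' k, (r ^ q) ^ k * a k ^ q := by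
  set S := ∑' k, (r ^ q) ^ k * a k ^ q with hS
  have hle : ∀ k, r ^ k * a k ≤ S ^ q⁻¹ := by
    intro k
    have h1 : (r ^ k * a k) ^ q ≤ S := by
      refine le_trans (le_of_eq ?_) (ENNReal.le_tsum k)
      rw [ENNReal.mul_rpow_of_nonneg _ _ hq.le, ← ENNReal.rpow_natCast, ← ENNReal.rpow_natCast,
        ← ENNReal.rpow_mul, ← ENNReal.rpow_mul, mul_comm q]
    exact (ENNReal.le_rpow_inv_iff hq).2 h1
  calc (∑' k, r ^ k * (r ^ k * a k)) ^ q ≤ (∑' k, r ^ k * S ^ q⁻¹) ^ q := by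
        refine ENNReal.rpow_le_rpow (ENNReal.tsum_le_tsum fun k => ?_) hq.le
        gcongr
        exact hle k
    _ = _ := by
        rw [ENNReal.tsum_mul_right, ENNReal.mul_rpow_of_nonneg _ _ hq.le, ← ENNReal.rpow_mul,
          inv_mul_cancel₀ hq.ne', ENNReal.rpow_one]

lemma tsum_ofReal_exp_mul_lt_top {c : ℝ} (hc : 0 < c) :
    ∑' k : ℕ, ENNReal.ofReal (Real.exp (-c)) ^ k * ENNReal.ofReal (k + 1) < ∞ := by
  have hr : ‖Real.exp (-c)‖ < 1 := by
    rw [Real.norm_eq_abs, Real.abs_exp]; exact Real.exp_lt_one_iff.2 (by linarith)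
  have h : Summable fun k : ℕ => Real.exp (-c) ^ k * ((k : ℝ) + 1) := by
    refine ((summable_pow_mul_geometric_of_norm_lt_one 1 hr).add
      (summable_geometric_of_norm_lt_one hr)).congr fun k => ?_
    ring
  refine lt_of_eq_of_lt (tsum_congr fun k => ?_) h.tsum_ofReal_lt_top
  rw [ENNReal.ofReal_mul (by positivity), ENNReal.ofReal_pow (Real.exp_pos _).le]

/-- The transform of a weight `w` with primitive `V` lies in `L^q` exactly when
`x ↦ V(x^{-1/lam})` does. -/
lemma lintegral_laplaceMass_rpow_lt_top_iff {lam q : ℝ} {w : ℝ → ℝ≥0∞} (hw : Measurable w)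
    (hlam : 0 < lam) (hq : 0 < q) :
    ∫⁻ x in Ioi 0, laplaceMass lam w x ^ q < ∞ ↔
      ∫⁻ x in Ioi 0, primitiveMass w (x ^ (-lam⁻¹)) ^ q < ∞ := by
  have hGm : Measurable fun x : ℝ => primitiveMass w (x ^ (-lam⁻¹)) ^ q :=
    ((primitiveMass_mono w).measurable.comp (by fun_prop)).pow_const _
  constructor
  · intro h
    have h1 : ENNReal.ofReal (Real.exp (-1)) ^ q *
        ∫⁻ x in Ioi 0, primitiveMass w (x ^ (-lam⁻¹)) ^ q < ∞ := by
      rw [← lintegral_const_mul _ hGm]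
      refine lt_of_le_of_lt (setLIntegral_mono' measurableSet_Ioi fun x hx => ?_) h
      rw [← ENNReal.mul_rpow_of_nonneg _ _ hq.le]
      exact ENNReal.rpow_le_rpow (exp_neg_one_mul_primitiveMass_le lam w hlam hx) hq.le
    refine lt_top_iff_ne_top.2 fun htop => h1.ne ?_
    rw [htop, ENNReal.mul_top]
    exact (ENNReal.rpow_pos (by simpa using Real.exp_pos _) ENNReal.ofReal_ne_top).ne'
  · intro h
    -- The weight `exp (-k) = r ^ k * r ^ k` is shared between the two factors of the estimate.
    set r : ℝ≥0∞ := ENNReal.ofReal (Real.exp (-(1 / 2))) with hr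
    have hexp : ∀ k : ℕ, ENNReal.ofReal (Real.exp (-k)) = r ^ k * r ^ k := by
      intro k
      rw [hr, ← ENNReal.ofReal_pow (Real.exp_pos _).le, ← ENNReal.ofReal_mul (by positivity),
        ← Real.exp_nat_mul, ← Real.exp_add]
      congr 2; ring
    have hrq : r ^ q = ENNReal.ofReal (Real.exp (-(q / 2))) := by
      rw [hr, ENNReal.ofReal_rpow_of_pos (Real.exp_pos _), ← Real.exp_mul]
      congr 2; ring
    have hc : ∑' k : ℕ, r ^ k < ∞ := by
      refine lt_of_le_of_lt (ENNReal.tsum_le_tsum fun k => ?_)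
        (tsum_ofReal_exp_mul_lt_top (c := 1 / 2) (by norm_num))
      refine le_mul_of_one_le_right (zero_le) ?_
      rw [ENNReal.one_le_ofReal]; linarith [k.cast_nonneg (α := ℝ)]
    have hpt : ∀ x ∈ Ioi (0 : ℝ), laplaceMass lam w x ^ q ≤ (∑' k : ℕ, r ^ k) ^ q *
        ∑' k : ℕ, (r ^ q) ^ k * primitiveMass w ((x / (k + 1)) ^ (-lam⁻¹)) ^ q := by
      intro x hx
      refine (ENNReal.rpow_le_rpow (laplaceMass_le_tsum hw hlam hx) hq.le).trans ?_
      simp only [hexp, mul_assoc]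
      exact tsum_pow_mul_pow_mul_rpow_le r _ hq
    have hkm : ∀ k : ℕ, Measurable fun x : ℝ =>
        primitiveMass w ((x / (k + 1)) ^ (-lam⁻¹)) ^ q := fun k =>
      hGm.comp (measurable_id.div_const ((k : ℝ) + 1))
    refine (setLIntegral_mono' measurableSet_Ioi hpt).trans_lt ?_
    rw [lintegral_const_mul _ (Measurable.tsum fun k => (hkm k).const_mul _),
      lintegral_tsum fun k => ((hkm k).const_mul _).aemeasurable]
    refine ENNReal.mul_lt_top (ENNReal.rpow_lt_top_of_nonneg hq.le hc.ne) ?_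
    have hk : ∀ k : ℕ, ∫⁻ x in Ioi 0, (r ^ q) ^ k *
        primitiveMass w ((x / (k + 1)) ^ (-lam⁻¹)) ^ q =
        (r ^ q) ^ k * ENNReal.ofReal (k + 1) *
          ∫⁻ x in Ioi 0, primitiveMass w (x ^ (-lam⁻¹)) ^ q := by
      intro k
      rw [lintegral_const_mul _ (hkm k), mul_assoc,
        ← lintegral_Ioi_comp_div hGm (by positivity : (0 : ℝ) < k + 1)]
    rw [tsum_congr hk, ENNReal.tsum_mul_right, hrq]
    exact ENNReal.mul_lt_top (tsum_ofReal_exp_mul_lt_top (by positivity)) h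

/-- For `q > 0` the transform of a weight lies in `L^q` exactly when
`∫ t^{-lam} V(t)^{q-1} w(t) dt` is finite. -/
lemma lintegral_laplaceMass_rpow_lt_top_iff' {lam q : ℝ} {w : ℝ → ℝ≥0∞} (hw : Measurable w)
    (hfin : ∀ t, primitiveMass w t < ∞) (hlam : 0 < lam) (hq : 0 < q) :
    ∫⁻ x in Ioi 0, laplaceMass lam w x ^ q < ∞ ↔
      ∫⁻ t in Ioi 0, ENNReal.ofReal (t ^ (-lam)) * primitiveMass w t ^ (q - 1) * w t < ∞ := by
  rw [lintegral_laplaceMass_rpow_lt_top_iff hw hlam hq,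
    lintegral_rpow_mul_primitiveMass hw hfin hlam hq]
  constructor
  · exact fun h => ENNReal.div_lt_top h.ne (by simpa using hq)
  · intro h
    refine lt_top_iff_ne_top.2 fun htop => h.ne ?_
    rw [htop, ENNReal.top_div_of_ne_top ENNReal.ofReal_ne_top]

/-- For `q < 1`, monotonicity of `V` gives `t^{-lam} V(t)^q ≤ A := ∫ V(x^{-1/lam})^q dx`, so the
factor `V^{q-1}` is at least a multiple of `t^{lam (q-1)/q}`. -/
lemma lintegral_rpow_div_mul_lt_top {lam q : ℝ} {w : ℝ → ℝ≥0∞} (hw : Measurable w)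
    (hfin : ∀ t, primitiveMass w t < ∞) (hlam : 0 < lam) (hq : 0 < q) (hq1 : q < 1)
    (h : ∫⁻ x in Ioi 0, laplaceMass lam w x ^ q < ∞) :
    ∫⁻ t in Ioi 0, ENNReal.ofReal (t ^ (-lam / q)) * w t < ∞ := by
  have hB := (lintegral_laplaceMass_rpow_lt_top_iff' hw hfin hlam hq).1 h
  set A := ∫⁻ x in Ioi 0, primitiveMass w (x ^ (-lam⁻¹)) ^ q with hA
  have hAfin : A < ∞ := (lintegral_laplaceMass_rpow_lt_top_iff hw hlam hq).1 h
  have hbound : ∀ t ∈ Ioi (0 : ℝ), ENNReal.ofReal (t ^ (-lam)) * primitiveMass w t ^ q ≤ A := by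
    intro t ht
    rw [mem_Ioi] at ht
    calc ENNReal.ofReal (t ^ (-lam)) * primitiveMass w t ^ q
        = ∫⁻ _ in Ioc 0 (t ^ (-lam)), primitiveMass w t ^ q := by
          rw [setLIntegral_const, Real.volume_Ioc, sub_zero, mul_comm]
      _ ≤ ∫⁻ x in Ioc 0 (t ^ (-lam)), primitiveMass w (x ^ (-lam⁻¹)) ^ q := by
          refine setLIntegral_mono' measurableSet_Ioc fun x hx => ?_
          refine ENNReal.rpow_le_rpow (primitiveMass_mono w ?_) hq.le
          have := (Real.le_rpow_inv_iff_of_neg (x := t) (y := x) (z := -lam) ht hx.1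
            (by linarith)).2 hx.2
          rwa [inv_neg] at this
      _ ≤ A := lintegral_mono_set Ioc_subset_Ioi_self
  have hpt : ∀ t ∈ Ioi (0 : ℝ), ENNReal.ofReal (t ^ (-lam / q)) ≤
      A ^ (1 / q - 1) * (ENNReal.ofReal (t ^ (-lam)) * primitiveMass w t ^ (q - 1)) ∨
      primitiveMass w t = 0 := by
    intro t ht
    rw [mem_Ioi] at ht
    by_cases h0 : primitiveMass w t = 0
    · exact Or.inr h0
    left
    have hVt := (hfin t).ne
    have hT0 : ENNReal.ofReal (t ^ (-lam)) ≠ 0 := by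
      simpa using Real.rpow_pos_of_pos ht _
    have e : ENNReal.ofReal (t ^ (-lam / q)) = ENNReal.ofReal (t ^ (-lam)) ^ (1 / q) := by
      rw [ENNReal.ofReal_rpow_of_pos (Real.rpow_pos_of_pos ht _), ← Real.rpow_mul ht.le]
      congr 2; ring
    have hs : (0 : ℝ) ≤ 1 / q - 1 := by
      rw [sub_nonneg, le_div_iff₀ hq]; linarith
    calc ENNReal.ofReal (t ^ (-lam / q))
        = (ENNReal.ofReal (t ^ (-lam)) * primitiveMass w t ^ q) ^ (1 / q - 1) *
            (ENNReal.ofReal (t ^ (-lam)) * primitiveMass w t ^ (q - 1)) := by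
          rw [ENNReal.mul_rpow_of_nonneg _ _ hs, ← ENNReal.rpow_mul, e]
          set T := ENNReal.ofReal (t ^ (-lam))
          set V := primitiveMass w t
          have hT : T ≠ ∞ := ENNReal.ofReal_ne_top
          have e1 : T ^ (1 / q) = T ^ (1 / q - 1) * T := by
            conv_rhs => rw [← ENNReal.rpow_one T, ← ENNReal.rpow_mul, one_mul,
              ← ENNReal.rpow_add _ _ hT0 hT]
            congr 1; ring
          have e2 : V ^ (q * (1 / q - 1)) * V ^ (q - 1) = 1 := by
            rw [← ENNReal.rpow_add _ _ h0 hVt]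
            have : q * (1 / q - 1) + (q - 1) = 0 := by field_simp; ring
            rw [this, ENNReal.rpow_zero]
          calc T ^ (1 / q) = T ^ (1 / q - 1) * T * (V ^ (q * (1 / q - 1)) * V ^ (q - 1)) := by
                rw [e2, mul_one, e1]
            _ = _ := by ring
      _ ≤ _ := by
          gcongr
          exact hbound t ht
  -- Where `V` vanishes, so does `w`, up to a null set.
  have hz : ∀ᵐ t ∂volume.restrict (Ioi (0 : ℝ)), primitiveMass w t = 0 → w t = 0 := by
    have hq2 : ∀ᵐ t ∂volume.restrict (Ioi (0 : ℝ)),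
        ENNReal.ofReal (t ^ (-lam)) * primitiveMass w t ^ (q - 1) * w t < ∞ := by
      refine ae_lt_top ?_ hB.ne
      have := (primitiveMass_mono w).measurable
      fun_prop
    filter_upwards [hq2, ae_restrict_mem measurableSet_Ioi] with t h1 ht h0
    by_contra hw0
    refine h1.ne ?_
    rw [h0, ENNReal.zero_rpow_of_neg (by linarith), ENNReal.mul_top, ENNReal.top_mul hw0]
    simpa using Real.rpow_pos_of_pos ht _
  calc ∫⁻ t in Ioi 0, ENNReal.ofReal (t ^ (-lam / q)) * w t
      ≤ ∫⁻ t in Ioi 0, A ^ (1 / q - 1) *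
          (ENNReal.ofReal (t ^ (-lam)) * primitiveMass w t ^ (q - 1) * w t) := by
        refine lintegral_mono_ae ?_
        filter_upwards [hz, ae_restrict_mem measurableSet_Ioi] with t h1 ht
        rcases hpt t ht with h2 | h2
        · rw [← mul_assoc]
          gcongr
        · rw [h1 h2]; simp
    _ = A ^ (1 / q - 1) * ∫⁻ t in Ioi 0,
          ENNReal.ofReal (t ^ (-lam)) * primitiveMass w t ^ (q - 1) * w t := by
        refine lintegral_const_mul' _ _ (ENNReal.rpow_lt_top_of_nonneg ?_ hAfin.ne).ne
        rw [sub_nonneg, le_div_iff₀ hq]; linarith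
    _ < ∞ := by
        refine ENNReal.mul_lt_top (ENNReal.rpow_lt_top_of_nonneg ?_ hAfin.ne) hB
        rw [sub_nonneg, le_div_iff₀ hq]; linarith

/-! ### The kernels `y ↦ exp (-x y^lam) v(y)` as elements of `L^r` -/

/-- The kernel `y ↦ exp (-x y^lam) v(y)` of the Laplace type transform at the point `x`. -/
noncomputable def laplaceKernel (lam : ℝ) (v : ℝ → ℝ) (x y : ℝ) : ℝ :=
  Real.exp (-(x * y ^ lam)) * v y

lemma exp_neg_mul_rpow_le_one {lam x y : ℝ} (hx : 0 ≤ x) (hy : 0 < y) :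
    Real.exp (-(x * y ^ lam)) ≤ 1 := by
  rw [Real.exp_le_one_iff, neg_nonpos]
  positivity

lemma aestronglyMeasurable_laplaceKernel {lam : ℝ} {v : ℝ → ℝ}
    (hv : AEStronglyMeasurable v halfLine) (x : ℝ) :
    AEStronglyMeasurable (laplaceKernel lam v x) halfLine :=
  AEStronglyMeasurable.mul (by fun_prop) hv

lemma memLp_laplaceKernel {lam : ℝ} {v : ℝ → ℝ} {r : ℝ≥0∞} (hv : MemLp v r halfLine) {x : ℝ}
    (hx : 0 ≤ x) : MemLp (laplaceKernel lam v x) r halfLine := by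
  refine hv.mono (aestronglyMeasurable_laplaceKernel hv.1 x) ?_
  filter_upwards [ae_restrict_mem measurableSet_Ioi] with y hy
  rw [laplaceKernel, norm_mul, Real.norm_eq_abs (Real.exp _), Real.abs_exp]
  exact mul_le_of_le_one_left (norm_nonneg _) (exp_neg_mul_rpow_le_one hx hy)

lemma laplaceKernel_laplaceKernel (lam : ℝ) (v : ℝ → ℝ) (a x : ℝ) :
    laplaceKernel lam (laplaceKernel lam v a) x = laplaceKernel lam v (a + x) := by
  ext y
  simp only [laplaceKernel]
  rw [← mul_assoc, ← Real.exp_add]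
  congr 2; ring

lemma tendsto_eLpNorm_mul_zero {α : Type*} [MeasurableSpace α] {μ : Measure α} {ι : Type*}
    {l : Filter ι} [l.IsCountablyGenerated] {v : α → ℝ} {r : ℝ≥0∞} (hr0 : r ≠ 0) (hr : r ≠ ∞)
    (hv : MemLp v r μ) {m : ι → α → ℝ} (hm : ∀ i, AEStronglyMeasurable (m i) μ)
    (hm1 : ∀ᶠ i in l, ∀ᵐ y ∂μ, |m i y| ≤ 1) (hm0 : ∀ᵐ y ∂μ, Tendsto (fun i => m i y) l (𝓝 0)) :
    Tendsto (fun i => eLpNorm (fun y => m i y * v y) r μ) l (𝓝 0) := by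
  have hrp : 0 < r.toReal := ENNReal.toReal_pos hr0 hr
  have key : Tendsto (fun i => ∫⁻ y, ‖m i y * v y‖ₑ ^ r.toReal ∂μ) l (𝓝 (∫⁻ _, 0 ∂μ)) := by
    refine tendsto_lintegral_filter_of_dominated_convergence' (fun y => ‖v y‖ₑ ^ r.toReal)
      (.of_forall fun i => ((hm i).mul hv.1).enorm.pow_const _) ?_ ?_ ?_
    · filter_upwards [hm1] with i hi
      filter_upwards [hi] with y hy
      refine ENNReal.rpow_le_rpow ?_ hrp.le
      rw [enorm_mul]
      refine mul_le_of_le_one_left (zero_le) ?_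
      rw [Real.enorm_eq_ofReal_abs]
      exact ENNReal.ofReal_le_one.2 hy
    · exact (lintegral_rpow_enorm_lt_top_of_eLpNorm_lt_top hr0 hr hv.2).ne
    · filter_upwards [hm0] with y hy
      have h1 : Tendsto (fun i => ‖m i y * v y‖ₑ) l (𝓝 0) := by
        have := (hy.mul_const (v y)).enorm
        simpa using this
      have := (ENNReal.continuous_rpow_const (y := r.toReal)).tendsto 0 |>.comp h1
      rwa [ENNReal.zero_rpow_of_pos hrp] at this
  simp only [eLpNorm_eq_lintegral_rpow_enorm_toReal hr0 hr]
  rw [lintegral_zero] at key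
  have := (ENNReal.continuous_rpow_const (y := 1 / r.toReal)).tendsto 0 |>.comp key
  rwa [ENNReal.zero_rpow_of_pos (by positivity)] at this

lemma tendsto_eLpNorm_laplaceKernel_sub {lam : ℝ} {v : ℝ → ℝ} {r : ℝ≥0∞} (hr0 : r ≠ 0)
    (hr : r ≠ ∞) (hv : MemLp v r halfLine) {x₀ : ℝ} (hx₀ : 0 ≤ x₀) :
    Tendsto (fun x => eLpNorm (laplaceKernel lam v x - laplaceKernel lam v x₀) r halfLine)
      (𝓝[Ici 0] x₀) (𝓝 0) := by
  have := tendsto_eLpNorm_mul_zero (l := 𝓝[Ici 0] x₀) hr0 hr hv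
    (m := fun x y => Real.exp (-(x * y ^ lam)) - Real.exp (-(x₀ * y ^ lam)))
    (fun x => by fun_prop) ?_ ?_
  · refine this.congr fun x => ?_
    congr 1
    ext y
    simp only [laplaceKernel, Pi.sub_apply]
    ring
  · filter_upwards [self_mem_nhdsWithin] with x hx
    filter_upwards [ae_restrict_mem measurableSet_Ioi] with y hy
    have h1 := exp_neg_mul_rpow_le_one (lam := lam) (mem_Ici.1 hx) hy
    have h2 := exp_neg_mul_rpow_le_one (lam := lam) hx₀ hy
    have h3 := Real.exp_pos (-(x * y ^ lam))
    have h4 := Real.exp_pos (-(x₀ * y ^ lam))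
    rw [abs_le]; constructor <;> linarith
  · refine .of_forall fun y => ?_
    have hc : Continuous fun x : ℝ => Real.exp (-(x * y ^ lam)) - Real.exp (-(x₀ * y ^ lam)) := by
      fun_prop
    have := hc.tendsto x₀
    rw [sub_self] at this
    exact this.mono_left nhdsWithin_le_nhds

lemma tendsto_eLpNorm_laplaceKernel_atTop {lam : ℝ} {v : ℝ → ℝ} {r : ℝ≥0∞} (hr0 : r ≠ 0)
    (hr : r ≠ ∞) (hv : MemLp v r halfLine) :
    Tendsto (fun x => eLpNorm (laplaceKernel lam v x) r halfLine) atTop (𝓝 0) := by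
  refine tendsto_eLpNorm_mul_zero (l := atTop) hr0 hr hv
    (m := fun x y => Real.exp (-(x * y ^ lam))) (fun x => by fun_prop) ?_ ?_
  · filter_upwards [eventually_ge_atTop 0] with x hx
    filter_upwards [ae_restrict_mem measurableSet_Ioi] with y hy
    rw [Real.abs_exp]
    exact exp_neg_mul_rpow_le_one hx hy
  · filter_upwards [ae_restrict_mem measurableSet_Ioi] with y hy
    exact Real.tendsto_exp_neg_atTop_nhds_zero.comp
      (tendsto_id.atTop_mul_const (Real.rpow_pos_of_pos hy _))

/-! ### The transform on `L^p` through Hölder's inequality -/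

section Transform

variable {𝕜 : Type*} [RCLike 𝕜] {lam : ℝ} {v : ℝ → ℝ} {p r : ℝ≥0∞}

lemma laplaceOp_laplaceKernel (f : ℝ → 𝕜) (a x : ℝ) :
    laplaceOp lam (laplaceKernel lam v a) f x = laplaceOp lam v f (a + x) := by
  have h := laplaceKernel_laplaceKernel lam v a x
  refine integral_congr_ae (.of_forall fun y => ?_)
  exact congrArg (· • f y) (congrFun h y)

lemma integrable_laplaceIntegrand [ENNReal.HolderConjugate r p] {f : ℝ → 𝕜}
    (hf : MemLp f p halfLine) {x : ℝ} (hk : MemLp (laplaceKernel lam v x) r halfLine) :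
    Integrable (laplaceIntegrand lam v f x) halfLine :=
  memLp_one_iff_integrable.1 (hf.smul hk)

lemma enorm_integral_smul_le [ENNReal.HolderConjugate r p] {f : ℝ → 𝕜} {k : ℝ → ℝ}
    (hf : AEStronglyMeasurable f halfLine) (hk : AEStronglyMeasurable k halfLine) :
    ‖∫ y, k y • f y ∂halfLine‖ₑ ≤ eLpNorm k r halfLine * eLpNorm f p halfLine := by
  have h : eLpNorm (k • f) 1 halfLine ≤ eLpNorm k r halfLine * eLpNorm f p halfLine :=
    eLpNorm_smul_le_mul_eLpNorm hf hk
  rw [eLpNorm_one_eq_lintegral_enorm] at h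
  exact (enorm_integral_le_lintegral_enorm _).trans h

lemma enorm_laplaceOp_le [ENNReal.HolderConjugate r p] {f : ℝ → 𝕜}
    (hf : AEStronglyMeasurable f halfLine) (hv : AEStronglyMeasurable v halfLine) (x : ℝ) :
    ‖laplaceOp lam v f x‖ₑ ≤
      eLpNorm (laplaceKernel lam v x) r halfLine * eLpNorm f p halfLine :=
  enorm_integral_smul_le hf (aestronglyMeasurable_laplaceKernel hv x)

lemma enorm_laplaceOp_sub_le [ENNReal.HolderConjugate r p] {f : ℝ → 𝕜}
    (hf : MemLp f p halfLine) {x z : ℝ} (hx : MemLp (laplaceKernel lam v x) r halfLine)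
    (hz : MemLp (laplaceKernel lam v z) r halfLine) :
    ‖laplaceOp lam v f x - laplaceOp lam v f z‖ₑ ≤
      eLpNorm (laplaceKernel lam v x - laplaceKernel lam v z) r halfLine *
        eLpNorm f p halfLine := by
  rw [laplaceOp, laplaceOp, ← integral_sub (integrable_laplaceIntegrand hf hx)
    (integrable_laplaceIntegrand hf hz)]
  refine le_trans (le_of_eq ?_) (enorm_integral_smul_le hf.1 (hx.1.sub hz.1))
  congr 2
  ext y
  simp only [laplaceIntegrand, laplaceKernel, Pi.sub_apply, sub_smul]

lemma aestronglyMeasurable_laplaceOp {f : ℝ → 𝕜} (hf : AEStronglyMeasurable f halfLine)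
    (hv : AEStronglyMeasurable v halfLine) :
    AEStronglyMeasurable (laplaceOp lam v f) halfLine := by
  have hexp : AEStronglyMeasurable (fun z : ℝ × ℝ => Real.exp (-(z.1 * z.2 ^ lam)))
      (halfLine.prod halfLine) := by fun_prop
  exact ((hexp.mul hv.comp_snd).smul hf.comp_snd).integral_prod_right'

/-! ### Extraction of convergent subsequences -/

lemma exists_subseq_cauchySeq_rat {F : ℕ → ℝ → 𝕜}
    (hF : ∀ x : ℝ, 0 < x → ∃ B : ℝ, ∀ n, ‖F n x‖ ≤ B) :
    ∃ φ : ℕ → ℕ, StrictMono φ ∧ ∀ ρ : ℚ, 0 < ρ → CauchySeq fun k => F (φ k) (ρ : ℝ) := by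
  choose! B hB using hF
  have hK : IsCompact (Set.pi univ fun ρ : {ρ : ℚ // 0 < ρ} =>
      Metric.closedBall (0 : 𝕜) (B (ρ : ℚ))) :=
    isCompact_univ_pi fun ρ => isCompact_closedBall _ _
  obtain ⟨a, -, φ, hφ, hlim⟩ := hK.tendsto_subseq
    (x := fun n (ρ : {ρ : ℚ // 0 < ρ}) => F n ((ρ : ℚ) : ℝ)) fun n ρ _ => by
      simpa using hB _ (by exact_mod_cast ρ.2) n
  refine ⟨φ, hφ, fun ρ hρ => ?_⟩
  exact (tendsto_pi_nhds.1 hlim ⟨ρ, hρ⟩).cauchySeq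

/-- The transforms of a bounded sequence are uniformly Cauchy on `[0, ∞)` once they are Cauchy at
the positive rationals: the kernels depend continuously on `x ∈ [0, ∞)` in `L^r` and tend to zero
at infinity, so that finitely many of them approximate all the others. -/
lemma uniformCauchySeqOn_laplaceOp [ENNReal.HolderConjugate r p] (hr0 : r ≠ 0) (hr : r ≠ ∞)
    (hv : MemLp v r halfLine) {f : ℕ → ℝ → 𝕜} (hf : ∀ n, MemLp (f n) p halfLine) {M : ℝ≥0}
    (hM : ∀ n, eLpNorm (f n) p halfLine ≤ M)
    (hrat : ∀ ρ : ℚ, 0 < ρ → CauchySeq fun n => laplaceOp lam v (f n) (ρ : ℝ)) :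
    UniformCauchySeqOn (fun n => laplaceOp lam v (f n)) atTop (Ici 0) := by
  rw [Metric.uniformCauchySeqOn_iff]
  intro ε hε
  -- `δ` is chosen so that kernels at distance at most `δ` give values at distance below `ε / 3`.
  obtain ⟨δ, hδ, hδM⟩ : ∃ δ : ℝ≥0, 0 < δ ∧ (δ : ℝ) * M < ε / 3 := by
    have hpos : 0 < ε / 3 / (M + 1) := by positivity
    refine ⟨(ε / 3 / (M + 1)).toNNReal, Real.toNNReal_pos.2 hpos, ?_⟩
    rw [Real.coe_toNNReal _ hpos.le, div_mul_eq_mul_div, div_lt_iff₀ (by positivity)]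
    have : (0 : ℝ) ≤ M := M.2
    nlinarith
  have small : ∀ {z : 𝕜} {n : ℕ} {k : ℝ → ℝ}, eLpNorm k r halfLine ≤ δ →
      ‖z‖ₑ ≤ eLpNorm k r halfLine * eLpNorm (f n) p halfLine → ‖z‖ < ε / 3 := by
    intro z n k hk hz
    have h1 : ‖z‖ₑ ≤ ((δ * M : ℝ≥0) : ℝ≥0∞) := by
      rw [ENNReal.coe_mul]
      exact hz.trans (mul_le_mul' hk (hM n))
    have h2 : ‖z‖₊ ≤ δ * M := by exact_mod_cast h1
    have h3 : ‖z‖ ≤ δ * M := by exact_mod_cast h2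
    exact h3.trans_lt hδM
  have hδ' : (0 : ℝ≥0∞) < δ := by exact_mod_cast hδ
  let P : Set ℝ → Prop := fun s => ∃ N, ∀ n ≥ N, ∀ m ≥ N, ∀ x ∈ s, 0 ≤ x →
    dist (laplaceOp lam v (f n) x) (laplaceOp lam v (f m) x) < ε
  have hPmono : ∀ ⦃s t⦄, s ⊆ t → P t → P s := fun s t hst ⟨N, hN⟩ =>
    ⟨N, fun n hn m hm x hx => hN n hn m hm x (hst hx)⟩
  have hPunion : ∀ ⦃s⦄, P s → ∀ ⦃t⦄, P t → P (s ∪ t) := by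
    rintro s ⟨N, hN⟩ t ⟨N', hN'⟩
    refine ⟨max N N', fun n hn m hm x hx => ?_⟩
    rcases hx with hx | hx
    · exact hN n (le_of_max_le_left hn) m (le_of_max_le_left hm) x hx
    · exact hN' n (le_of_max_le_right hn) m (le_of_max_le_right hm) x hx
  -- Near infinity all values are small.
  obtain ⟨X, hX0, hX⟩ : ∃ X : ℝ, 0 ≤ X ∧ ∀ x ≥ X,
      eLpNorm (laplaceKernel lam v x) r halfLine ≤ δ := by
    have h := (tendsto_eLpNorm_laplaceKernel_atTop (lam := lam) hr0 hr hv).eventually_lt_const hδ'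
    obtain ⟨X, hX⟩ := eventually_atTop.1 h
    exact ⟨max X 0, le_max_right _ _, fun x hx => (hX x (le_of_max_le_left hx)).le⟩
  have hinf : P (Ici X) := by
    refine ⟨0, fun n _ m _ x hx _ => ?_⟩
    have h1 : ∀ n, ‖laplaceOp lam v (f n) x‖ < ε / 3 := fun n =>
      small (hX x hx) (enorm_laplaceOp_le (hf n).1 hv.1 x)
    rw [dist_eq_norm]
    linarith [norm_sub_le (laplaceOp lam v (f n) x) (laplaceOp lam v (f m) x), h1 n, h1 m]
  -- Near a point `x₀`, all values are close to those at one and the same rational point.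
  have hloc : ∀ x₀ ∈ Icc (0 : ℝ) X, ∃ t ∈ 𝓝[Icc 0 X] x₀, P t := by
    intro x₀ hx₀
    have hδ2 : (0 : ℝ≥0∞) < (δ / 2 : ℝ≥0) := by exact_mod_cast half_pos hδ
    have h := (tendsto_eLpNorm_laplaceKernel_sub (lam := lam) hr0 hr hv hx₀.1).eventually_lt_const
      hδ2
    obtain ⟨η, hη, hball⟩ := Metric.mem_nhdsWithin_iff.1 h
    obtain ⟨ρ, hρ1, hρ2⟩ := exists_rat_btwn (show x₀ < x₀ + η by linarith)
    have hρ0 : (0 : ℝ) < ρ := hx₀.1.trans_lt hρ1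
    have hρball : (ρ : ℝ) ∈ Metric.ball x₀ η ∩ Ici 0 := by
      refine ⟨?_, hρ0.le⟩
      rw [Metric.mem_ball, Real.dist_eq, abs_lt]
      constructor <;> linarith
    have hball' : ∀ x ∈ Metric.ball x₀ η ∩ Ici 0,
        eLpNorm (laplaceKernel lam v x - laplaceKernel lam v x₀) r halfLine ≤ (δ / 2 : ℝ≥0) :=
      fun x hx => le_of_lt (hball hx)
    have hρk := hball' _ hρball
    refine ⟨Metric.ball x₀ η, mem_nhdsWithin_of_mem_nhds (Metric.ball_mem_nhds x₀ hη), ?_⟩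
    obtain ⟨N, hN⟩ := Metric.cauchySeq_iff.1 (hrat ρ (by exact_mod_cast hρ0)) (ε / 3)
      (by positivity)
    refine ⟨N, fun n hn m hm x hx hx0 => ?_⟩
    have hk : eLpNorm (laplaceKernel lam v x - laplaceKernel lam v ρ) r halfLine ≤ δ := by
      have hmx := (memLp_laplaceKernel (lam := lam) hv hx0).1
      have hm0 := (memLp_laplaceKernel (lam := lam) hv hx₀.1).1
      have hmρ := (memLp_laplaceKernel (lam := lam) hv hρ0.le).1
      have e : laplaceKernel lam v x - laplaceKernel lam v ρ =
          (laplaceKernel lam v x - laplaceKernel lam v x₀) -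
            (laplaceKernel lam v ρ - laplaceKernel lam v x₀) := by abel
      have h1r : 1 ≤ r := ENNReal.HolderConjugate.one_le r p
      rw [e]
      refine (eLpNorm_sub_le (hmx.sub hm0) (hmρ.sub hm0) h1r).trans ?_
      refine (add_le_add (hball' x ⟨hx, hx0⟩) hρk).trans ?_
      rw [← ENNReal.coe_add, add_halves]
    have h1 : ∀ n, ‖laplaceOp lam v (f n) x - laplaceOp lam v (f n) ρ‖ < ε / 3 := fun n =>
      small hk (enorm_laplaceOp_sub_le (hf n) (memLp_laplaceKernel hv hx0)
        (memLp_laplaceKernel hv hρ0.le))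
    have h2 := h1 n
    have h3 := h1 m
    have h4 := hN n hn m hm
    rw [← dist_eq_norm] at h2 h3
    calc _ ≤ dist (laplaceOp lam v (f n) x) (laplaceOp lam v (f n) ρ) +
          dist (laplaceOp lam v (f n) ρ) (laplaceOp lam v (f m) ρ) +
          dist (laplaceOp lam v (f m) ρ) (laplaceOp lam v (f m) x) := dist_triangle4 _ _ _ _
      _ < ε := by rw [dist_comm (laplaceOp lam v (f m) ρ)]; linarith
  have hcpt : P (Icc 0 X) :=
    isCompact_Icc.induction_on ⟨0, fun _ _ _ _ x hx => hx.elim⟩ hPmono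
      (fun s t hs ht => hPunion hs ht) hloc
  obtain ⟨N, hN⟩ := hPunion hcpt hinf
  refine ⟨N, fun n hn m hm x hx => hN m hm n hn x ?_ hx |> fun h => by rwa [dist_comm] at h⟩
  rcases le_total x X with h | h
  · exact Or.inl ⟨hx, h⟩
  · exact Or.inr h

lemma exists_norm_laplaceOp_le [ENNReal.HolderConjugate r p]
    {f : ℕ → ℝ → 𝕜} (hf : ∀ n, MemLp (f n) p halfLine) {M : ℝ≥0}
    (hM : ∀ n, eLpNorm (f n) p halfLine ≤ M) (hv : AEStronglyMeasurable v halfLine) {x : ℝ}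
    (hk : MemLp (laplaceKernel lam v x) r halfLine) :
    ∃ B : ℝ, ∀ n, ‖laplaceOp lam v (f n) x‖ ≤ B := by
  refine ⟨(eLpNorm (laplaceKernel lam v x) r halfLine * M).toReal, fun n => ?_⟩
  rw [← toReal_enorm]
  refine ENNReal.toReal_mono (ENNReal.mul_lt_top hk.2 ENNReal.coe_lt_top).ne ?_
  refine (enorm_laplaceOp_le (r := r) (p := p) (hf n).1 hv x).trans ?_
  gcongr
  exact hM n

/-- If the kernels at all `x > 0` lie in `L^r`, every bounded sequence has a subsequence whose
transforms converge at every `x > 0`. -/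
lemma exists_subseq_forall_pos_cauchySeq [ENNReal.HolderConjugate r p] (hr0 : r ≠ 0)
    (hr : r ≠ ∞) (hv : AEStronglyMeasurable v halfLine)
    (hk : ∀ x : ℝ, 0 < x → MemLp (laplaceKernel lam v x) r halfLine)
    {f : ℕ → ℝ → 𝕜} (hf : ∀ n, MemLp (f n) p halfLine) {M : ℝ≥0}
    (hM : ∀ n, eLpNorm (f n) p halfLine ≤ M) :
    ∃ φ : ℕ → ℕ, StrictMono φ ∧
      ∀ x : ℝ, 0 < x → CauchySeq fun k => laplaceOp lam v (f (φ k)) x := by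
  obtain ⟨φ, hφ, hrat⟩ := exists_subseq_cauchySeq_rat
    (F := fun n => laplaceOp lam v (f n)) fun x hx => 
      exists_norm_laplaceOp_le (p := p) hf hM hv (hk x hx)
  refine ⟨φ, hφ, fun x hx => ?_⟩
  obtain ⟨a, ha0, hax⟩ := exists_rat_btwn hx
  have ha0' : 0 < a := by exact_mod_cast ha0
  have h := uniformCauchySeqOn_laplaceOp (lam := lam) hr0 hr (hk a ha0)
    (fun n => hf (φ n)) (fun n => hM (φ n)) fun ρ hρ => by
      simp only [laplaceOp_laplaceKernel]
      exact_mod_cast hrat (a + ρ) (by positivity)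
  have := h.cauchySeq (x := x - a) (by simpa using hax.le)
  simpa only [laplaceOp_laplaceKernel, add_sub_cancel] using this

end Transform

/-! ### Transforms of nonnegative functions -/

lemma laplaceMass_congr {lam : ℝ} {w w' : ℝ → ℝ≥0∞} (h : w =ᵐ[halfLine] w') :
    laplaceMass lam w = laplaceMass lam w' := by
  ext x
  refine lintegral_congr_ae ?_
  filter_upwards [h] with y hy
  rw [hy]

lemma primitiveMass_congr {w w' : ℝ → ℝ≥0∞} (h : w =ᵐ[halfLine] w') :
    primitiveMass w = primitiveMass w' := by
  ext t
  exact lintegral_congr_ae (ae_restrict_of_ae_restrict_of_subset Ioc_subset_Ioi_self h)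

lemma enorm_laplaceOp_ofReal {𝕜 : Type*} [RCLike 𝕜] {lam : ℝ} {v g : ℝ → ℝ}
    (hv : ∀ᵐ y ∂halfLine, 0 ≤ v y) (hg : ∀ᵐ y ∂halfLine, 0 ≤ g y) {x : ℝ}
    (hint : Integrable (laplaceIntegrand lam v (fun y => (g y : 𝕜)) x) halfLine) :
    ‖laplaceOp lam v (fun y => (g y : 𝕜)) x‖ₑ =
      laplaceMass lam (fun y => ENNReal.ofReal (v y * g y)) x := by
  have e : laplaceIntegrand lam v (fun y => (g y : 𝕜)) x =
      fun y => ((Real.exp (-(x * y ^ lam)) * (v y * g y) : ℝ) : 𝕜) := by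
    ext y
    rw [laplaceIntegrand, RCLike.real_smul_eq_coe_mul]
    push_cast
    ring
  have hnn : ∀ᵐ y ∂halfLine, 0 ≤ Real.exp (-(x * y ^ lam)) * (v y * g y) := by
    filter_upwards [hv, hg] with y h1 h2
    positivity
  have hint' : Integrable (fun y => Real.exp (-(x * y ^ lam)) * (v y * g y)) halfLine := by
    rw [e] at hint
    simpa using hint.re
  rw [laplaceOp, e, integral_ofReal, ← ofReal_norm, RCLike.norm_ofReal,
    abs_of_nonneg (integral_nonneg_of_ae hnn), ofReal_integral_eq_lintegral_ofReal hint' hnn]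
  refine lintegral_congr fun y => ?_
  rw [ENNReal.ofReal_mul (Real.exp_pos _).le]

lemma exists_mem_Ioo_of_ae {P : ℝ → Prop} (h : ∀ᵐ x ∂halfLine, P x) {x : ℝ} (hx : 0 < x) :
    ∃ z ∈ Ioo 0 x, P z := by
  have h1 : ∀ᵐ z ∂volume.restrict (Ioo 0 x), P z :=
    ae_restrict_of_ae_restrict_of_subset Ioo_subset_Ioi_self h
  have : NeBot (ae (volume.restrict (Ioo 0 x))) := by
    rw [ae_neBot, Ne, Measure.restrict_eq_zero, Real.volume_Ioo]
    simpa using hx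
  obtain ⟨z, hz, hP⟩ := ((ae_restrict_mem measurableSet_Ioo).and h1).exists
  exact ⟨z, hz, hP⟩

lemma lintegral_le_of_laplaceMass_le {lam : ℝ} {w : ℝ → ℝ≥0∞} (hw : AEMeasurable w halfLine)
    {C : ℝ≥0∞} (h : ∀ x : ℝ, 0 < x → laplaceMass lam w x ≤ C) :
    ∫⁻ y, w y ∂halfLine ≤ C := by
  have hlim : Tendsto (fun n : ℕ => laplaceMass lam w (1 / ((n : ℝ) + 1))) atTop
      (𝓝 (∫⁻ y, w y ∂halfLine)) := by
    refine lintegral_tendsto_of_tendsto_of_monotone (fun n => ?_) ?_ ?_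
    · exact AEMeasurable.mul (by fun_prop) hw
    · filter_upwards [ae_restrict_mem measurableSet_Ioi] with y hy n m hnm
      have : 0 ≤ y ^ lam := Real.rpow_nonneg (le_of_lt hy) _
      have h2 : 1 / ((m : ℝ) + 1) ≤ 1 / ((n : ℝ) + 1) := by gcongr
      dsimp only
      gcongr
    · refine .of_forall fun y => ?_
      have h1 : Tendsto (fun n : ℕ => Real.exp (-(1 / ((n : ℝ) + 1) * y ^ lam))) atTop (𝓝 1) := by
        have := ((tendsto_one_div_add_atTop_nhds_zero_nat (𝕜 := ℝ)).mul_const (y ^ lam)).neg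
        rw [zero_mul, neg_zero] at this
        simpa [Function.comp_def] using (Real.continuous_exp.tendsto 0).comp this
      have h2 := ENNReal.tendsto_ofReal h1
      rw [ENNReal.ofReal_one] at h2
      simpa using ENNReal.Tendsto.mul_const h2 (b := w y) (Or.inl one_ne_zero)
  exact le_of_tendsto' hlim fun n => h _ (by positivity)

/-- For nonnegative `g`, letting `x` tend to `0` bounds `∫ v g` by the supremum of the transform
of `g`. -/
lemma lintegral_mul_le_eLpNorm_laplaceOp {𝕜 : Type*} [RCLike 𝕜] {lam : ℝ} {v g : ℝ → ℝ}
    (hv : ∀ᵐ y ∂halfLine, 0 ≤ v y) (hg : ∀ᵐ y ∂halfLine, 0 ≤ g y)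
    (hvm : AEMeasurable v halfLine) (hgm : AEMeasurable g halfLine)
    (hint : ∀ᵐ x ∂halfLine, Integrable (laplaceIntegrand lam v (fun y => (g y : 𝕜)) x) halfLine) :
    ∫⁻ y, ENNReal.ofReal (v y * g y) ∂halfLine ≤
      eLpNorm (laplaceOp lam v (fun y => (g y : 𝕜))) ∞ halfLine := by
  refine lintegral_le_of_laplaceMass_le (lam := lam) (hvm.mul hgm).ennreal_ofReal fun x hx => ?_
  have hae : ∀ᵐ x ∂halfLine, laplaceMass lam (fun y => ENNReal.ofReal (v y * g y)) x ≤
      eLpNorm (laplaceOp lam v (fun y => (g y : 𝕜))) ∞ halfLine := by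
    rw [eLpNorm_exponent_top]
    filter_upwards [hint, enorm_ae_le_eLpNormEssSup (laplaceOp lam v fun y => (g y : 𝕜)) halfLine]
      with x h1 h2
    rwa [← enorm_laplaceOp_ofReal hv hg h1]
  obtain ⟨z, hz, hle⟩ := exists_mem_Ioo_of_ae hae hx
  exact (laplaceMass_antitone lam _ hz.2.le).trans hle

lemma LocLp.aestronglyMeasurable {v : ℝ → ℝ} {r : ℝ≥0∞} (h : LocLp v r) :
    AEStronglyMeasurable v halfLine := by
  have h1 : AEStronglyMeasurable v (volume.restrict (⋃ n : ℕ, Icc (0 : ℝ) (n + 1))) :=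
    AEStronglyMeasurable.iUnion fun n : ℕ => (h (n + 1) (by positivity)).1
  refine h1.mono_measure (Measure.restrict_mono (fun x hx => ?_) le_rfl)
  obtain ⟨n, hn⟩ := exists_nat_ge x
  exact mem_iUnion.2 ⟨n, le_of_lt hx, hn.trans (by linarith)⟩

lemma LocLp.primitiveMass_lt_top {v : ℝ → ℝ} (h : LocLp v 1) (t : ℝ) :
    primitiveMass (fun y => ENNReal.ofReal (v y)) t < ∞ := by
  have h1 := (memLp_one_iff_integrable.1 (h (max t 1) (by positivity))).lintegral_lt_top
  have hsub : Ioc 0 t ⊆ Icc 0 (max t 1) := fun y hy =>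
    ⟨hy.1.le, hy.2.trans (le_max_left _ _)⟩
  exact (lintegral_mono_set hsub).trans_lt h1

/-! ### Compactness from `L^∞` to `L^q` -/

section TopToFinite

variable {𝕜 : Type*} [RCLike 𝕜] {lam q : ℝ} {v : ℝ → ℝ}

lemma eLpNorm_laplaceKernel_one (hv : ∀ᵐ y ∂halfLine, 0 ≤ v y) (x : ℝ) :
    eLpNorm (laplaceKernel lam v x) 1 halfLine =
      laplaceMass lam (fun y => ENNReal.ofReal (v y)) x := by
  rw [eLpNorm_one_eq_lintegral_enorm]
  refine lintegral_congr_ae ?_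
  filter_upwards [hv] with y hy
  rw [laplaceKernel, enorm_mul, Real.enorm_of_nonneg (Real.exp_pos _).le, Real.enorm_of_nonneg hy]

/-- Testing on the constant function `1`. -/
lemma LaplaceCompact.lintegral_laplaceMass_lt_top (hq : 0 < q) (hv : ∀ᵐ y ∂halfLine, 0 ≤ v y)
    (h : LaplaceCompact 𝕜 lam v ∞ (ENNReal.ofReal q)) :
    ∫⁻ x in Ioi 0, laplaceMass lam (fun y => ENNReal.ofReal (v y)) x ^ q < ∞ := by
  have h1 : MemLp (fun _ : ℝ => ((1 : ℝ) : 𝕜)) ∞ halfLine := memLp_top_const _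
  have h2 := lintegral_rpow_enorm_lt_top_of_eLpNorm_lt_top (by simpa using hq)
    ENNReal.ofReal_ne_top (h.memLp _ h1).2
  rw [ENNReal.toReal_ofReal hq.le] at h2
  refine lt_of_eq_of_lt (lintegral_congr_ae ?_) h2
  filter_upwards [h.integrable _ h1] with x hx
  rw [enorm_laplaceOp_ofReal hv (.of_forall fun _ => zero_le_one) hx]
  simp

/-- The transforms of a bounded sequence are dominated by a multiple of the transform
of `v`, so pointwise convergence of a subsequence is convergence in `L^q`. -/
lemma laplaceCompact_of_lintegral_laplaceMass_lt_top (hq : 0 < q)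
    (hv : ∀ᵐ y ∂halfLine, 0 ≤ v y) (hvm : AEStronglyMeasurable v halfLine)
    (h : ∫⁻ x in Ioi 0, laplaceMass lam (fun y => ENNReal.ofReal (v y)) x ^ q < ∞) :
    LaplaceCompact 𝕜 lam v ∞ (ENNReal.ofReal q) := by
  set Φ := laplaceMass lam (fun y => ENNReal.ofReal (v y)) with hΦ
  have hΦm : Measurable Φ := (laplaceMass_antitone lam _).measurable
  have hq0 : ENNReal.ofReal q ≠ 0 := by simpa using hq
  have hqr : (ENNReal.ofReal q).toReal = q := ENNReal.toReal_ofReal hq.le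
  have hΦfin : ∀ x : ℝ, 0 < x → Φ x < ∞ := by
    intro x hx
    obtain ⟨z, hz, hlt⟩ := exists_mem_Ioo_of_ae (ae_lt_top (hΦm.pow_const q) h.ne) hx
    exact (laplaceMass_antitone lam _ hz.2.le).trans_lt
      ((ENNReal.rpow_lt_top_iff_of_pos hq).1 hlt)
  have hk : ∀ x : ℝ, 0 < x → MemLp (laplaceKernel lam v x) 1 halfLine := fun x hx =>
    ⟨aestronglyMeasurable_laplaceKernel hvm x, by
      rw [eLpNorm_laplaceKernel_one hv]; exact hΦfin x hx⟩
  have hle : ∀ f : ℝ → 𝕜, MemLp f ∞ halfLine → ∀ x,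
      ‖laplaceOp lam v f x‖ₑ ≤ Φ x * eLpNorm f ∞ halfLine := fun f hf x => by
    rw [hΦ, ← eLpNorm_laplaceKernel_one hv]
    exact enorm_laplaceOp_le hf.1 hvm x
  have hdom : ∀ M : ℝ≥0∞, M < ∞ → ∫⁻ x, (Φ x * M) ^ q ∂halfLine < ∞ := by
    intro M hM
    simp only [ENNReal.mul_rpow_of_nonneg _ _ hq.le]
    rw [lintegral_mul_const _ (hΦm.pow_const q)]
    exact ENNReal.mul_lt_top h (ENNReal.rpow_lt_top_of_nonneg hq.le hM.ne)
  have hmem : ∀ g : ℝ → 𝕜, AEStronglyMeasurable g halfLine → ∀ M : ℝ≥0∞, M < ∞ →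
      (∀ᵐ x ∂halfLine, ‖g x‖ₑ ≤ Φ x * M) → MemLp g (ENNReal.ofReal q) halfLine := by
    intro g hg M hM hgM
    refine ⟨hg, ?_⟩
    rw [eLpNorm_lt_top_iff_lintegral_rpow_enorm_lt_top hq0 ENNReal.ofReal_ne_top, hqr]
    refine (lintegral_mono_ae ?_).trans_lt (hdom M hM)
    filter_upwards [hgM] with x hx
    exact ENNReal.rpow_le_rpow hx hq.le
  refine ⟨fun f hf => ?_, fun f hf => ?_, fun f hf hM => ?_⟩
  · filter_upwards [ae_restrict_mem measurableSet_Ioi] with x hx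
    exact integrable_laplaceIntegrand hf (hk x hx)
  · exact hmem _ (aestronglyMeasurable_laplaceOp hf.1 hvm) _ hf.2 (.of_forall (hle f hf))
  · obtain ⟨M, hM⟩ := hM
    obtain ⟨φ, hφ, hcauchy⟩ := exists_subseq_forall_pos_cauchySeq (lam := lam) (r := 1)
      one_ne_zero ENNReal.one_ne_top hvm hk hf hM
    have hex : ∀ x : ℝ, 0 < x → ∃ l : 𝕜,
        Tendsto (fun k => laplaceOp lam v (f (φ k)) x) atTop (𝓝 l) := fun x hx =>
      cauchySeq_tendsto_of_complete (hcauchy x hx)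
    choose! g hg using hex
    have hae : ∀ᵐ x ∂halfLine, Tendsto (fun k => laplaceOp lam v (f (φ k)) x) atTop (𝓝 (g x)) := by
      filter_upwards [ae_restrict_mem measurableSet_Ioi] with x hx using hg x hx
    have hFm : ∀ k, AEStronglyMeasurable (laplaceOp lam v (f (φ k))) halfLine := fun k =>
      aestronglyMeasurable_laplaceOp (hf _).1 hvm
    have hgm : AEStronglyMeasurable g halfLine := aestronglyMeasurable_of_tendsto_ae _ hFm hae
    have hFM : ∀ k x, ‖laplaceOp lam v (f (φ k)) x‖ₑ ≤ Φ x * M := fun k x =>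
      (hle _ (hf _) x).trans (by gcongr; exact hM _)
    have hgM : ∀ᵐ x ∂halfLine, ‖g x‖ₑ ≤ Φ x * M := by
      filter_upwards [hae] with x hx
      exact le_of_tendsto' hx.enorm fun k => hFM k x
    refine ⟨φ, hφ, g, hmem g hgm M ENNReal.coe_lt_top hgM, ?_⟩
    have key : Tendsto (fun k => ∫⁻ x, ‖laplaceOp lam v (f (φ k)) x - g x‖ₑ ^ q ∂halfLine) atTop
        (𝓝 (∫⁻ _, 0 ∂halfLine)) := by
      refine tendsto_lintegral_of_dominated_convergence' (fun x => (Φ x * (M + M)) ^ q)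
        (fun k => ((hFm k).sub hgm).enorm.pow_const _) (fun k => ?_)
        (hdom _ (by simp)).ne ?_
      · filter_upwards [hgM] with x hx
        refine ENNReal.rpow_le_rpow ?_ hq.le
        rw [mul_add]
        exact (enorm_sub_le).trans (add_le_add (hFM k x) hx)
      · filter_upwards [hae] with x hx
        have h1 : Tendsto (fun k => ‖laplaceOp lam v (f (φ k)) x - g x‖ₑ) atTop (𝓝 0) := by
          simpa using (hx.sub_const (g x)).enorm
        have := (ENNReal.continuous_rpow_const (y := q)).tendsto 0 |>.comp h1
        rwa [ENNReal.zero_rpow_of_pos hq] at this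
    simp only [eLpNorm_eq_lintegral_rpow_enorm_toReal hq0 ENNReal.ofReal_ne_top, hqr]
    rw [lintegral_zero] at key
    have := (ENNReal.continuous_rpow_const (y := 1 / q)).tendsto 0 |>.comp key
    rwa [ENNReal.zero_rpow_of_pos (by positivity)] at this

lemma laplaceCompact_top_iff (hq : 0 < q) (hv : ∀ᵐ y ∂halfLine, 0 ≤ v y)
    (hvm : AEStronglyMeasurable v halfLine) :
    LaplaceCompact 𝕜 lam v ∞ (ENNReal.ofReal q) ↔
      ∫⁻ x in Ioi 0, laplaceMass lam (fun y => ENNReal.ofReal (v y)) x ^ q < ∞ :=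
  ⟨fun h => h.lintegral_laplaceMass_lt_top hq hv,
    laplaceCompact_of_lintegral_laplaceMass_lt_top hq hv hvm⟩

/-- Compactness from `L^∞` to `L^q` is characterised by `constGtOne` for every `q > 0`. -/
lemma laplaceCompact_top_iff_constGtOne (hlam : 0 < lam) (hq : 0 < q)
    (hv : ∀ᵐ y ∂halfLine, 0 ≤ v y) (hloc : LocLp v 1) :
    LaplaceCompact 𝕜 lam v ∞ (ENNReal.ofReal q) ↔ constGtOne lam q v < ∞ := by
  have hvm := hloc.aestronglyMeasurable
  have hwm := hvm.aemeasurable.ennreal_ofReal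
  have hw := hwm.ae_eq_mk
  have hfin : ∀ t, primitiveMass (hwm.mk _) t < ∞ := fun t => by
    rw [← primitiveMass_congr hw]; exact hloc.primitiveMass_lt_top t
  rw [laplaceCompact_top_iff hq hv hvm, laplaceMass_congr hw,
    lintegral_laplaceMass_rpow_lt_top_iff' hwm.measurable_mk hfin hlam hq, constGtOne,
    ENNReal.rpow_lt_top_iff_of_pos (by positivity), ← primitiveMass_congr hw]
  refine iff_of_eq (congrArg (· < ∞) (lintegral_congr_ae ?_))
  filter_upwards [hw] with t ht
  rw [← ht, primitiveMass]

lemma LaplaceCompact.constLtOne_lt_top (hlam : 0 < lam) (hq : 0 < q) (hq1 : q < 1)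
    (hv : ∀ᵐ y ∂halfLine, 0 ≤ v y) (hloc : LocLp v 1)
    (h : LaplaceCompact 𝕜 lam v ∞ (ENNReal.ofReal q)) : constLtOne lam q v < ∞ := by
  have hvm := hloc.aestronglyMeasurable
  have hwm := hvm.aemeasurable.ennreal_ofReal
  have hw := hwm.ae_eq_mk
  have hfin : ∀ t, primitiveMass (hwm.mk _) t < ∞ := fun t => by
    rw [← primitiveMass_congr hw]; exact hloc.primitiveMass_lt_top t
  rw [laplaceCompact_top_iff hq hv hvm, laplaceMass_congr hw] at h
  refine lt_of_eq_of_lt (lintegral_congr_ae ?_)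
    (lintegral_rpow_div_mul_lt_top hwm.measurable_mk hfin hlam hq hq1 h)
  filter_upwards [hw] with t ht
  rw [← ht]

lemma constC_lt_top_iff (hq : 0 < q) : constC lam q v < ∞ ↔ constGtOne lam q v < ∞ := by
  rw [constC]
  split_ifs with h
  · subst h
    simp [constEqOne, constGtOne]
  · rfl

end TopToFinite

/-! ### Compactness from `L^p` to `L^∞` -/

section ToTop

variable {𝕜 : Type*} [RCLike 𝕜] {lam : ℝ} {v : ℝ → ℝ} {p r : ℝ≥0∞}

lemma laplaceCompact_to_top [ENNReal.HolderConjugate r p] (hr0 : r ≠ 0) (hr : r ≠ ∞)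
    (hv : MemLp v r halfLine) : LaplaceCompact 𝕜 lam v p ∞ := by
  have hk : ∀ x : ℝ, 0 < x → MemLp (laplaceKernel lam v x) r halfLine := fun x hx =>
    memLp_laplaceKernel hv hx.le
  have hle : ∀ f : ℝ → 𝕜, MemLp f p halfLine → ∀ x > 0,
      ‖laplaceOp lam v f x‖ₑ ≤ eLpNorm v r halfLine * eLpNorm f p halfLine := by
    intro f hf x hx
    refine (enorm_laplaceOp_le (r := r) (p := p) hf.1 hv.1 x).trans ?_
    gcongr
    refine eLpNorm_mono_ae ?_
    filter_upwards [ae_restrict_mem measurableSet_Ioi] with y hy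
    rw [laplaceKernel, norm_mul, Real.norm_eq_abs (Real.exp _), Real.abs_exp]
    exact mul_le_of_le_one_left (norm_nonneg _) (exp_neg_mul_rpow_le_one (le_of_lt hx) hy)
  have hmem : ∀ f : ℝ → 𝕜, MemLp f p halfLine → MemLp (laplaceOp lam v f) ∞ halfLine := by
    intro f hf
    refine ⟨aestronglyMeasurable_laplaceOp hf.1 hv.1, ?_⟩
    rw [eLpNorm_exponent_top]
    refine lt_of_le_of_lt (essSup_le_of_ae_le (eLpNorm v r halfLine * eLpNorm f p halfLine) ?_)
      (ENNReal.mul_lt_top hv.2 hf.2)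
    filter_upwards [ae_restrict_mem measurableSet_Ioi] with x hx using hle f hf x hx
  refine ⟨fun f hf => ?_, hmem, fun f hf hM => ?_⟩
  · filter_upwards [ae_restrict_mem measurableSet_Ioi] with x hx
    exact integrable_laplaceIntegrand hf (hk x hx)
  · obtain ⟨M, hM⟩ := hM
    obtain ⟨φ, hφ, hrat⟩ := exists_subseq_cauchySeq_rat (F := fun n => laplaceOp lam v (f n))
      fun x hx => exists_norm_laplaceOp_le (p := p) hf hM hv.1 (hk x hx)
    have hunif := uniformCauchySeqOn_laplaceOp (lam := lam) hr0 hr hv (fun n => hf (φ n))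
      (fun n => hM (φ n)) hrat
    have hex : ∀ x ∈ Ici (0 : ℝ), ∃ l : 𝕜,
        Tendsto (fun k => laplaceOp lam v (f (φ k)) x) atTop (𝓝 l) := fun x hx =>
      cauchySeq_tendsto_of_complete (hunif.cauchySeq hx)
    choose! g hg using hex
    have hlim := hunif.tendstoUniformlyOn_of_tendsto hg
    have hgm : AEStronglyMeasurable g halfLine := by
      refine aestronglyMeasurable_of_tendsto_ae (f := fun k => laplaceOp lam v (f (φ k))) atTop
        (fun k => aestronglyMeasurable_laplaceOp (hf _).1 hv.1) ?_
      filter_upwards [ae_restrict_mem measurableSet_Ioi] with x hx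
      exact hg x (Ioi_subset_Ici_self hx)
    have hsmall : ∀ ε : ℝ, 0 < ε → ∀ᶠ k in atTop,
        eLpNorm (laplaceOp lam v (f (φ k)) - g) ∞ halfLine ≤ ENNReal.ofReal ε := by
      intro ε hε
      filter_upwards [Metric.tendstoUniformlyOn_iff.1 hlim ε hε] with k hk
      rw [eLpNorm_exponent_top]
      refine essSup_le_of_ae_le _ ?_
      filter_upwards [ae_restrict_mem measurableSet_Ioi] with x hx
      rw [Pi.sub_apply, ← ofReal_norm, ← dist_eq_norm, dist_comm]
      exact ENNReal.ofReal_le_ofReal (hk x (Ioi_subset_Ici_self hx)).le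
    refine ⟨φ, hφ, g, ?_, ?_⟩
    · obtain ⟨k, hk⟩ := (hsmall 1 one_pos).exists
      have h1 : MemLp (laplaceOp lam v (f (φ k)) - g) ∞ halfLine :=
        ⟨(aestronglyMeasurable_laplaceOp (hf _).1 hv.1).sub hgm,
          hk.trans_lt ENNReal.ofReal_lt_top⟩
      simpa using (hmem _ (hf (φ k))).sub h1
    · refine ENNReal.tendsto_nhds_zero.2 fun ε hε => ?_
      rcases eq_or_ne ε ∞ with rfl | hε'
      · exact .of_forall fun _ => le_top
      · have := hsmall ε.toReal (ENNReal.toReal_pos hε.ne' hε')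
        rwa [ENNReal.ofReal_toReal hε'] at this

lemma LaplaceCompact.eLpNorm_one_lt_top (hv : ∀ᵐ y ∂halfLine, 0 ≤ v y)
    (hvm : AEStronglyMeasurable v halfLine) (h : LaplaceCompact 𝕜 lam v ∞ ∞) :
    eLpNorm v 1 halfLine < ∞ := by
  have h1 : MemLp (fun _ : ℝ => ((1 : ℝ) : 𝕜)) ∞ halfLine := memLp_top_const _
  have h2 := lintegral_mul_le_eLpNorm_laplaceOp (𝕜 := 𝕜) (lam := lam) (g := fun _ => 1) hv
    (.of_forall fun _ => zero_le_one) hvm.aemeasurable aemeasurable_const (h.integrable _ h1)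
  refine lt_of_le_of_lt ?_ (h.memLp _ h1).2
  refine le_trans (le_of_eq ?_) h2
  rw [eLpNorm_one_eq_lintegral_enorm]
  refine lintegral_congr_ae ?_
  filter_upwards [hv] with y hy
  rw [mul_one, Real.enorm_of_nonneg hy]

/-- By compactness, any bounded sequence in `L^p` has a subsequence along which the transforms are
bounded in `L^∞`. Applied to the extremal functions of Hölder's inequality for `v` on `(0, n]`,
this bounds `v` in `L^r`. -/
lemma LaplaceCompact.eLpNorm_lt_top [hrp : ENNReal.HolderConjugate r p] (hr1 : 1 < r)
    (hr : r ≠ ∞) (hv : ∀ᵐ y ∂halfLine, 0 ≤ v y) (hloc : LocLp v r)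
    (h : LaplaceCompact 𝕜 lam v p ∞) : eLpNorm v r halfLine < ∞ := by
  have hvm := hloc.aestronglyMeasurable
  have hr0 : r ≠ 0 := (zero_lt_one.trans hr1).ne'
  have hp1 : 1 < p := by
    have := hrp.symm
    exact (ENNReal.HolderConjugate.lt_top_iff_one_lt r p).1 hr.lt_top
  have hp : p ≠ ∞ := by
    have := hrp.symm
    exact ((ENNReal.HolderConjugate.lt_top_iff_one_lt p r).2 hr1).ne
  have hp0 : p ≠ 0 := (zero_lt_one.trans hp1).ne'
  set R := r.toReal with hR
  set P := p.toReal with hP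
  have hRP : R.HolderConjugate P := ENNReal.HolderConjugate.toReal_of_ne_top hr hp
  have hR0 : 0 < R := hRP.pos
  have hP0 : 0 < P := hRP.symm.pos
  -- The masses of `v ^ R` on `(0, n]`.
  set A : ℕ → ℝ≥0∞ := fun n => ∫⁻ y in Ioc (0 : ℝ) n, ENNReal.ofReal (v y) ^ R with hA
  have hAmono : Monotone A := fun n m hnm =>
    lintegral_mono_set (Ioc_subset_Ioc_right (by exact_mod_cast hnm))
  have hAfin : ∀ n, A n < ∞ := by
    intro n
    have h1 := lintegral_rpow_enorm_lt_top_of_eLpNorm_lt_top hr0 hr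
      (hloc (n + 1) (by positivity)).2
    refine lt_of_le_of_lt ?_ h1
    refine (lintegral_mono_set (t := Icc (0 : ℝ) (n + 1)) fun y hy => ?_).trans ?_
    · exact ⟨hy.1.le, hy.2.trans (by linarith)⟩
    · refine lintegral_mono fun y => ENNReal.rpow_le_rpow ?_ hR0.le
      rw [Real.enorm_eq_ofReal_abs]
      exact ENNReal.ofReal_le_ofReal (le_abs_self _)
  set c : ℕ → ℝ := fun n => ((A n).toReal ^ (1 / P))⁻¹ with hc
  have hc0 : ∀ n, 0 ≤ c n := fun n => by positivity
  set u : ℕ → ℝ → ℝ := fun n => (Ioc (0 : ℝ) n).indicator fun y => v y ^ (R - 1) with hu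
  have hum : ∀ n, AEStronglyMeasurable (u n) halfLine := fun n =>
    ((hvm.aemeasurable.pow_const _).indicator measurableSet_Ioc).aestronglyMeasurable
  have hu0 : ∀ n, ∀ᵐ y ∂halfLine, 0 ≤ u n y := by
    intro n
    filter_upwards [hv] with y hy
    exact indicator_apply_nonneg fun _ => Real.rpow_nonneg hy _
  have hAint : ∀ n : ℕ, ∫⁻ y, (Ioc (0 : ℝ) n).indicator (fun y => ENNReal.ofReal (v y) ^ R) y
      ∂halfLine = A n := by
    intro n
    rw [lintegral_indicator measurableSet_Ioc, Measure.restrict_restrict measurableSet_Ioc,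
      inter_eq_left.2 Ioc_subset_Ioi_self]
  -- The norm of `u n` is `(A n) ^ (1 / P)`, so `c n * u n` has norm at most one.
  have hunorm : ∀ n, eLpNorm (u n) p halfLine = A n ^ (1 / P) := by
    intro n
    rw [eLpNorm_eq_lintegral_rpow_enorm_toReal hp0 hp, ← hAint n]
    congr 1
    refine lintegral_congr_ae ?_
    filter_upwards [hv] with y hy
    by_cases hyn : y ∈ Ioc (0 : ℝ) n
    · simp only [hu, indicator_of_mem hyn]
      rw [← hP, Real.enorm_of_nonneg (Real.rpow_nonneg hy _),
        ENNReal.ofReal_rpow_of_nonneg (Real.rpow_nonneg hy _) hP0.le, ← Real.rpow_mul hy,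
        ENNReal.ofReal_rpow_of_nonneg hy hR0.le, hRP.sub_one_mul_conj]
    · simp only [hu, indicator_of_notMem hyn]
      rw [enorm_zero, ENNReal.zero_rpow_of_pos hP0]
  have hcA : ∀ n, ENNReal.ofReal (c n) * A n ^ (1 / P) ≤ 1 := by
    intro n
    rw [← ENNReal.ofReal_toReal (hAfin n).ne,
      ENNReal.ofReal_rpow_of_nonneg ENNReal.toReal_nonneg (by positivity),
      ← ENNReal.ofReal_mul (hc0 n), ENNReal.ofReal_le_one]
    exact inv_mul_le_one
  have hcA' : ∀ n, ENNReal.ofReal (c n) * A n = A n ^ (1 / R) := by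
    intro n
    have ha : 0 ≤ (A n).toReal := ENNReal.toReal_nonneg
    conv_lhs => rw [← ENNReal.ofReal_toReal (hAfin n).ne]
    conv_rhs => rw [← ENNReal.ofReal_toReal (hAfin n).ne]
    rw [ENNReal.ofReal_rpow_of_nonneg ha (by positivity), ← ENNReal.ofReal_mul (hc0 n)]
    congr 1
    rcases ha.eq_or_lt with h0 | h0
    · rw [← h0, mul_zero, Real.zero_rpow (by positivity)]
    · simp only [hc]
      rw [← Real.rpow_neg ha]
      nth_rewrite 2 [← Real.rpow_one (A n).toReal]
      rw [← Real.rpow_add h0]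
      congr 1
      have := hRP.inv_add_inv_eq_one
      rw [one_div, one_div]; linarith
  set F : ℕ → ℝ → 𝕜 := fun n y => ((c n * u n y : ℝ) : 𝕜) with hF
  have hFnorm : ∀ n, eLpNorm (F n) p halfLine ≤ 1 := by
    intro n
    have e : eLpNorm (F n) p halfLine = eLpNorm (c n • u n) p halfLine := by
      refine eLpNorm_congr_norm_ae (.of_forall fun y => ?_)
      simp only [hF, RCLike.norm_ofReal, Pi.smul_apply, smul_eq_mul, Real.norm_eq_abs]
    rw [e, eLpNorm_const_smul, Real.enorm_of_nonneg (hc0 n), hunorm]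
    exact hcA n
  have hFmem : ∀ n, MemLp (F n) p halfLine := fun n =>
    ⟨RCLike.continuous_ofReal.comp_aestronglyMeasurable ((hum n).const_mul (c n)),
      (hFnorm n).trans_lt ENNReal.one_lt_top⟩
  have hlow : ∀ n, A n ^ (1 / R) ≤ eLpNorm (laplaceOp lam v (F n)) ∞ halfLine := by
    intro n
    refine le_trans (le_of_eq ?_) (lintegral_mul_le_eLpNorm_laplaceOp (𝕜 := 𝕜) (lam := lam)
      (g := fun y => c n * u n y) hv ?_ hvm.aemeasurable ((hum n).const_mul (c n)).aemeasurable
      (h.integrable _ (hFmem n)))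
    · rw [← hcA', ← hAint, ← lintegral_const_mul' _ _ ENNReal.ofReal_ne_top]
      refine lintegral_congr_ae ?_
      filter_upwards [hv] with y hy
      by_cases hyn : y ∈ Ioc (0 : ℝ) n
      · simp only [hu, indicator_of_mem hyn]
        rw [ENNReal.ofReal_rpow_of_nonneg hy hR0.le, ← ENNReal.ofReal_mul (hc0 n)]
        congr 1
        have : v y ^ R = v y * v y ^ (R - 1) := by
          rcases hy.eq_or_lt with h0 | h0
          · rw [← h0, zero_mul, Real.zero_rpow hR0.ne']
          · nth_rewrite 2 [← Real.rpow_one (v y)]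
            rw [← Real.rpow_add h0]
            congr 1; ring
        rw [this]; ring
      · simp only [hu, indicator_of_notMem hyn, mul_zero, ENNReal.ofReal_zero]
    · filter_upwards [hu0 n] with y hy
      exact mul_nonneg (hc0 n) hy
  obtain ⟨φ, hφ, g, hg, hlim⟩ := h.compact F hFmem ⟨1, by simpa using hFnorm⟩
  set C : ℝ≥0∞ := 1 + eLpNorm g ∞ halfLine with hC
  have hCfin : C < ∞ := ENNReal.add_lt_top.2 ⟨ENNReal.one_lt_top, hg.2⟩
  have hbound : ∀ n, A n ≤ C ^ R := by
    intro n
    obtain ⟨k, hk1, hkn⟩ := ((hlim.eventually_lt_const zero_lt_one).and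
      (eventually_ge_atTop n)).exists
    have h1 : A (φ k) ^ (1 / R) ≤ C := by
      refine (hlow (φ k)).trans ?_
      have e : laplaceOp lam v (F (φ k)) = (laplaceOp lam v (F (φ k)) - g) + g := by simp
      rw [e]
      refine (eLpNorm_add_le ((h.memLp _ (hFmem _)).1.sub hg.1) hg.1 le_top).trans ?_
      exact add_le_add hk1.le le_rfl
    calc A n ≤ A (φ k) := hAmono (hkn.trans (hφ.id_le k))
      _ = (A (φ k) ^ (1 / R)) ^ R := by
        rw [← ENNReal.rpow_mul, one_div_mul_cancel hR0.ne', ENNReal.rpow_one]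
      _ ≤ C ^ R := ENNReal.rpow_le_rpow h1 hR0.le
  have htotal : ∫⁻ y, ENNReal.ofReal (v y) ^ R ∂halfLine ≤ C ^ R := by
    have hU : ⋃ n : ℕ, Ioc (0 : ℝ) n = Ioi 0 := by
      ext y
      simp only [mem_iUnion, mem_Ioc, mem_Ioi]
      exact ⟨fun ⟨_, h1⟩ => h1.1, fun h1 => (exists_nat_ge y).imp fun n hn => ⟨h1, hn⟩⟩
    rw [halfLine, ← hU, setLIntegral_iUnion_of_directed]
    · exact iSup_le hbound
    · exact Monotone.directed_le fun n m hnm => Ioc_subset_Ioc_right (by exact_mod_cast hnm)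
  rw [eLpNorm_lt_top_iff_lintegral_rpow_enorm_lt_top hr0 hr]
  refine lt_of_eq_of_lt (lintegral_congr_ae ?_)
    (htotal.trans_lt (ENNReal.rpow_lt_top_of_nonneg hR0.le hCfin.ne))
  filter_upwards [hv] with y hy
  rw [Real.enorm_of_nonneg hy]

end ToTop

theorem theorem5p1 (𝕜 : Type*) [RCLike 𝕜] (lam : ℝ) (hlam : 0 < lam)
    (v : ℝ → ℝ) (hv : ∀ᵐ y ∂halfLine, 0 ≤ v y) :
    (LocLp v 1 → ∀ q : ℝ, 1 ≤ q →
      (LaplaceCompact 𝕜 lam v ∞ (ENNReal.ofReal q) ↔ constC lam q v < ∞)) ∧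
    (LocLp v 1 → ∀ q : ℝ, 0 < q → q < 1 →
      (constGtOne lam q v < ∞ → LaplaceCompact 𝕜 lam v ∞ (ENNReal.ofReal q)) ∧
      (LaplaceCompact 𝕜 lam v ∞ (ENNReal.ofReal q) → constLtOne lam q v < ∞)) ∧
    (∀ p : ℝ≥0∞, 1 < p → LocLp v p.conjExponent →
      (LaplaceCompact 𝕜 lam v p ∞ ↔ eLpNorm v p.conjExponent halfLine < ∞)) := by
  refine ⟨fun hloc q hq => ?_, fun hloc q hq hq1 => ⟨?_, ?_⟩, fun p hp hloc => ?_⟩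
  · have hq0 : 0 < q := zero_lt_one.trans_le hq
    rw [constC_lt_top_iff hq0, laplaceCompact_top_iff_constGtOne hlam hq0 hv hloc]
  · exact (laplaceCompact_top_iff_constGtOne hlam hq hv hloc).2
  · exact fun h => h.constLtOne_lt_top hlam hq hq1 hv hloc
  · have hpr : ENNReal.HolderConjugate p p.conjExponent := .conjExponent hp.le
    have hrp : ENNReal.HolderConjugate p.conjExponent p := hpr.symm
    have hr : p.conjExponent ≠ ∞ :=
      ((ENNReal.HolderConjugate.lt_top_iff_one_lt p.conjExponent p).2 hp).ne
    have h1r : 1 ≤ p.conjExponent := ENNReal.HolderConjugate.one_le _ p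
    refine ⟨fun h => ?_, fun h => ?_⟩
    · rcases h1r.eq_or_lt with h1 | h1
      · have hp' : p = ∞ := by
          by_contra hne
          have := (ENNReal.HolderConjugate.lt_top_iff_one_lt p p.conjExponent).1
            (lt_top_iff_ne_top.2 hne)
          exact this.ne h1
        subst hp'
        rw [← h1]
        exact h.eLpNorm_one_lt_top hv hloc.aestronglyMeasurable
      · exact h.eLpNorm_lt_top h1 hr hv hloc
    · exact laplaceCompact_to_top (zero_lt_one.trans_le h1r).ne' hr
        ⟨hloc.aestronglyMeasurable, h⟩
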